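/- All simplicial complexes are finite. For a simplicial complex $K$, a set $T$ of vertices is a \emph{missing face} of $K$ if $T\notin K$ but every proper subset of $T$ belongs to $K$. If $u\neq v$ are vertices of $K$ that are not both contained in a missing face of $K$ of dimension at most $\dim K$, then passing from $K$ to $K'=\{T : u\notin T\in K\}\cup\{(T\setminus\{u\})\cup\{v\} : u\in T\in K\}$ is an \emph{admissible contraction}; passing from $K$ to a subcomplex is a \emph{deletion}. Write $H<K$ if (up to isomorphism) $H$ is obtained from $K$ by a finite sequence of admissible contractions and deletions. Let $K_\times=\bigcup\{S\times T : S,T\in K \text{ nonempty},\ S\cap T=\emptyset\}$ be the deleted product, with its cellular chain complex $C_\bullet(K_\times)=\bigoplus\mathbb{Z}(S\times T)$, boundary $\partial(S\times T)=\partial S\times T+(-1)^{\dim S}S\times\partial T$ and $\mathbb{Z}_2$-action $\tau(S\times T)=(-1)^{\dim S\dim T}\,T\times S$. Let $H^m_{eq}(K_\times)$ be the $m$-th cohomology group of the complex of integral cochains $c$ with $\tau c=(-1)^m c$ (symmetric cochains for $m$ even, antisymmetric cochains for $m$ odd). Define $H^m_{eq}(S^\infty)$ in the same way from the singular cochains of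 the infinite-dimensional sphere $S^\infty$ with the antipodal action. Let $i:K_\times\to S^\infty$ be a $\mathbb{Z}_2$-map (it is unique up to $\mathbb{Z}_2$-homotopy), let $z$ be a generator of $H^m_{eq}(S^\infty)$, and let $o^m_{\mathbb{Z}}(K_\times)=i^*(z)\in H^m_{eq}(K_\times)$ be the Van Kampen obstruction, which is well defined up to sign. \textbf{Theorem.} Let $H$ and $K$ be finite simplicial complexes and let $m\ge 0$. If $H<K$ and $o^m_{\mathbb{Z}}(H_\times)\neq 0$, then $o^m_{\mathbb{Z}}(K_\times)\neq 0$. -/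

import Mathlib

noncomputable section

namespace VanKampen

universe u v w

/-! ### Chain complexes with involution and their equivariant cohomology -/

/-- A non-negatively graded chain complex of abelian groups with an involutive chain map `τ`. -/
structure InvComplex where
  /-- the group of `n`-chains -/
  C : ℕ → Type u
  [grp : ∀ n, AddCommGroup (C n)]
  /-- the boundary map -/
  d : ∀ n, C (n + 1) →+ C n
  /-- the `ℤ/2`-action -/
  τ : ∀ n, C n →+ C n
  d_d : ∀ n x, d n (d (n + 1) x) = 0
  τ_τ : ∀ n x, τ n (τ n x) = x
  d_τ : ∀ n x, d n (τ (n + 1) x) = τ n (d n x)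

attribute [instance] InvComplex.grp

/-- A chain map that commutes with the involutions. -/
structure InvComplex.Hom (A : InvComplex.{u}) (B : InvComplex.{v}) where
  /-- the homomorphism in degree `n` -/
  f : ∀ n, A.C n →+ B.C n
  map_d : ∀ n x, f n (A.d n x) = B.d n (f (n + 1) x)
  map_τ : ∀ n x, f n (A.τ n x) = B.τ n (f n x)

/-- Composition of equivariant chain maps. -/
def InvComplex.Hom.comp {A : InvComplex.{u}} {B : InvComplex.{v}} {D : InvComplex.{w}}
    (g : B.Hom D) (f : A.Hom B) : A.Hom D where
  f n := (g.f n).comp (f.f n)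
  map_d n x := by simp [f.map_d, g.map_d]
  map_τ n x := by simp [f.map_τ, g.map_τ]

/-- The `j`-cochains `c : C_j → ℤ` with `τ c = (-1) ^ m • c`: the symmetric cochains if `m` is
even and the antisymmetric cochains if `m` is odd. -/
def InvComplex.eqCochains (A : InvComplex.{u}) (m j : ℕ) : AddSubgroup (A.C j →+ ℤ) where
  carrier := {c | ∀ x, c (A.τ j x) = (-1) ^ m * c x}
  zero_mem' := by simp
  add_mem' := by
    intro a b ha hb x
    simp only [Set.mem_ofPred_eq] at ha hb
    simp [ha, hb, mul_add]
  neg_mem' := by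
    intro a ha x
    simp only [Set.mem_ofPred_eq] at ha
    simp [ha]

/-- The `m`-cocycles of the complex of symmetric (`m` even) or antisymmetric (`m` odd)
cochains. -/
def InvComplex.eqCocycles (A : InvComplex.{u}) (m : ℕ) : AddSubgroup (A.C m →+ ℤ) :=
  A.eqCochains m m ⊓ (AddMonoidHom.compHom' (P := ℤ) (A.d m)).ker

/-- The `m`-coboundaries of the complex of symmetric (`m` even) or antisymmetric (`m` odd)
cochains: the coboundaries of the `(m - 1)`-cochains with the symmetry prescribed by `m`. -/
def InvComplex.eqCoboundaries (A : InvComplex.{u}) : ∀ m : ℕ, AddSubgroup (A.C m →+ ℤ)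
  | 0 => ⊥
  | m + 1 => (A.eqCochains (m + 1) m).map (AddMonoidHom.compHom' (P := ℤ) (A.d m))

/-- The equivariant cohomology group `H_eq^m`, that is, the `m`-th cohomology group of the complex
of symmetric cochains if `m` is even, and of the complex of antisymmetric cochains if `m` is
odd. -/
abbrev InvComplex.Heq (A : InvComplex.{u}) (m : ℕ) : Type u :=
  A.eqCocycles m ⧸ (A.eqCoboundaries m).addSubgroupOf (A.eqCocycles m)

lemma InvComplex.Hom.comp_mem_eqCochains {A : InvComplex.{u}} {B : InvComplex.{v}} (f : A.Hom B)
    (m j : ℕ) {c : B.C j →+ ℤ} (hc : c ∈ B.eqCochains m j) :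
    c.comp (f.f j) ∈ A.eqCochains m j := by
  intro x
  have := hc (f.f j x)
  simpa [f.map_τ] using this

lemma InvComplex.Hom.comp_mem_eqCocycles {A : InvComplex.{u}} {B : InvComplex.{v}} (f : A.Hom B)
    (m : ℕ) {c : B.C m →+ ℤ} (hc : c ∈ B.eqCocycles m) :
    c.comp (f.f m) ∈ A.eqCocycles m := by
  refine ⟨f.comp_mem_eqCochains m m hc.1, ?_⟩
  have h2 : c.comp (B.d m) = 0 := hc.2
  change (c.comp (f.f m)).comp (A.d m) = 0
  ext x
  have := DFunLike.congr_fun h2 (f.f (m + 1) x)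
  simpa [f.map_d] using this

/-- Pull-back of equivariant cocycles along an equivariant chain map. -/
def InvComplex.Hom.cocycleMap {A : InvComplex.{u}} {B : InvComplex.{v}} (f : A.Hom B) (m : ℕ) :
    B.eqCocycles m →+ A.eqCocycles m where
  toFun c := ⟨c.1.comp (f.f m), f.comp_mem_eqCocycles m c.2⟩
  map_zero' := by ext; simp
  map_add' a b := by ext; simp

/-- The homomorphism `f^* : H_eq^m(B) → H_eq^m(A)` induced by an equivariant chain map
`f : A → B`. -/
def InvComplex.Hom.pullback {A : InvComplex.{u}} {B : InvComplex.{v}} (f : A.Hom B) (m : ℕ) :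
    B.Heq m →+ A.Heq m :=
  QuotientAddGroup.map _ _ (f.cocycleMap m) <| by
    rintro ⟨c, hc⟩ h
    rw [AddSubgroup.mem_addSubgroupOf] at h
    rw [AddSubgroup.mem_comap, AddSubgroup.mem_addSubgroupOf]
    change c.comp (f.f m) ∈ A.eqCoboundaries m
    cases m with
    | zero =>
      have h0 : c = 0 := h
      subst h0
      exact AddSubgroup.zero_mem _
    | succ m =>
      obtain ⟨b, hb, hbc⟩ := h
      refine ⟨b.comp (f.f m), f.comp_mem_eqCochains (m + 1) m hb, ?_⟩
      have hbc' : b.comp (B.d m) = c := hbc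
      ext x
      simp [← hbc', f.map_d]

/-! ### Singular chains of a space with involution -/

/-- A continuous involution of a topological space. -/
structure ContInvolution (X : Type u) [TopologicalSpace X] where
  /-- the underlying continuous map -/
  map : C(X, X)
  invol : ∀ x, map (map x) = x

/-- The singular `n`-simplices of `X`. -/
abbrev SingSimplex (X : Type u) [TopologicalSpace X] (n : ℕ) : Type u :=
  C(stdSimplex ℝ (Fin (n + 1)), X)

/-- The affine map of standard simplices that is induced by a map of their vertices. -/
def simplexMap {k l : ℕ} (f : Fin k → Fin l) :
    C(stdSimplex ℝ (Fin k), stdSimplex ℝ (Fin l)) :=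
  ⟨stdSimplex.map f, stdSimplex.continuous_map f⟩

/-- The `i`-th face of a singular simplex. -/
def SingSimplex.face {X : Type u} [TopologicalSpace X] {n : ℕ} (σ : SingSimplex X (n + 1))
    (i : Fin (n + 2)) : SingSimplex X n :=
  σ.comp (simplexMap i.succAbove)

lemma SingSimplex.face_face {X : Type u} [TopologicalSpace X] {n : ℕ}
    (σ : SingSimplex X (n + 2)) (i : Fin (n + 2)) (j : Fin (n + 3)) (h : (j : ℕ) ≤ (i : ℕ)) :
    (σ.face j).face i
      = (σ.face i.succ).face (Fin.castLT j (lt_of_le_of_lt h i.isLt)) := by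
  have key : j.succAbove ∘ i.succAbove
      = i.succ.succAbove ∘ (Fin.castLT j (lt_of_le_of_lt h i.isLt)).succAbove := by
    funext x
    apply Fin.ext
    simp only [Function.comp_apply, Fin.succAbove, Fin.lt_def, Fin.val_castSucc, Fin.val_succ,
      Fin.val_castLT]
    split_ifs <;> simp_all <;> omega
  apply ContinuousMap.ext
  intro x
  simp only [SingSimplex.face, simplexMap, ContinuousMap.comp_apply, ContinuousMap.coe_mk,
    stdSimplex.map_comp_apply]
  rw [show (j.succAbove : Fin (n + 2) → Fin (n + 3)).comp i.succAbove
    = j.succAbove ∘ i.succAbove from rfl, key]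

/-- The boundary map `∂ σ = ∑ i, (-1) ^ i σ ∘ δ_i` of singular chains. -/
def singBoundary (X : Type u) [TopologicalSpace X] (n : ℕ) :
    (SingSimplex X (n + 1) →₀ ℤ) →+ (SingSimplex X n →₀ ℤ) :=
  (Finsupp.linearCombination ℤ fun σ : SingSimplex X (n + 1) =>
    ∑ i : Fin (n + 2), (-1 : ℤ) ^ (i : ℕ) • Finsupp.single (σ.face i) (1 : ℤ)).toAddMonoidHom

/-- The map of singular chains that is induced by a continuous map. -/
def singMap {X : Type u} {Y : Type v} [TopologicalSpace X] [TopologicalSpace Y] (g : C(X, Y))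
    (n : ℕ) : (SingSimplex X n →₀ ℤ) →+ (SingSimplex Y n →₀ ℤ) :=
  Finsupp.mapDomain.addMonoidHom fun σ => g.comp σ

lemma singBoundary_single {X : Type u} [TopologicalSpace X] {n : ℕ} (σ : SingSimplex X (n + 1)) :
    singBoundary X n (Finsupp.single σ 1)
      = ∑ i : Fin (n + 2), (-1 : ℤ) ^ (i : ℕ) • Finsupp.single (σ.face i) (1 : ℤ) := by
  simp [singBoundary]

lemma singMap_single {X : Type u} {Y : Type v} [TopologicalSpace X] [TopologicalSpace Y]
    (g : C(X, Y)) {n : ℕ} (σ : SingSimplex X n) :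
    singMap g n (Finsupp.single σ 1) = Finsupp.single (g.comp σ) 1 := by
  simp [singMap]

lemma singBoundary_singBoundary (X : Type u) [TopologicalSpace X] (n : ℕ)
    (x : SingSimplex X (n + 2) →₀ ℤ) : singBoundary X n (singBoundary X (n + 1) x) = 0 := by
  have : (singBoundary X n).comp (singBoundary X (n + 1)) = 0 := by
    apply Finsupp.addHom_ext'
    intro σ
    ext1
    simp only [AddMonoidHom.comp_apply, Finsupp.singleAddHom_apply, singBoundary_single, map_sum,
      map_zsmul, Finset.smul_sum, AddMonoidHom.zero_apply]
    rw [Finset.sum_comm]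
    simp only [← Finset.sum_product', smul_smul]
    let P := Fin (n + 2) × Fin (n + 3)
    let S : Finset P := {ij : P | (ij.2 : ℕ) ≤ (ij.1 : ℕ)}
    rw [Finset.univ_product_univ, ← Finset.sum_add_sum_compl S, ← eq_neg_iff_add_eq_zero,
      ← Finset.sum_neg_distrib]
    let φ : ∀ ij : P, ij ∈ S → P := fun ij hij =>
      (Fin.castLT ij.2 (lt_of_le_of_lt (Finset.mem_filter.mp hij).right (Fin.is_lt ij.1)),
        ij.1.succ)
    apply Finset.sum_bij φ
    · intro ij hij
      simp_rw [S, φ, Finset.compl_filter, Finset.mem_filter_univ, Fin.val_succ,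
        Fin.val_castLT] at hij ⊢
      lia
    · rintro ⟨i, j⟩ hij ⟨i', j'⟩ hij' h
      rw [Prod.mk_inj]
      exact ⟨by simpa [φ] using! congr_arg Prod.snd h,
        by simpa [φ, Fin.castSucc_castLT] using! congr_arg Fin.castSucc (congr_arg Prod.fst h)⟩
    · rintro ⟨i', j'⟩ hij'
      simp_rw [S, Finset.compl_filter, Finset.mem_filter_univ, not_le] at hij'
      refine ⟨(j'.pred <| ?_, Fin.castSucc i'), ?_, ?_⟩
      · rintro rfl
        simp only [Fin.val_zero, not_lt_zero] at hij'
      · simpa [S] using! Nat.le_sub_one_of_lt hij'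
      · simp only [φ, Fin.castLT_castSucc, Fin.succ_pred]
    · rintro ⟨i, j⟩ hij
      have hle : (j : ℕ) ≤ (i : ℕ) := (Finset.mem_filter.mp hij).right
      simp only [φ]
      rw [SingSimplex.face_face σ i j hle, ← neg_smul]
      congr 1
      simp only [Fin.val_succ, Fin.val_castLT]
      ring
  exact DFunLike.congr_fun this x

lemma singMap_singBoundary {X : Type u} {Y : Type v} [TopologicalSpace X] [TopologicalSpace Y]
    (g : C(X, Y)) (n : ℕ) (x : SingSimplex X (n + 1) →₀ ℤ) :
    singMap g n (singBoundary X n x) = singBoundary Y n (singMap g (n + 1) x) := by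
  have : (singMap g n).comp (singBoundary X n) = (singBoundary Y n).comp (singMap g (n + 1)) := by
    apply Finsupp.addHom_ext'
    intro σ
    ext1
    simp only [AddMonoidHom.comp_apply, Finsupp.singleAddHom_apply, singBoundary_single, map_sum,
      map_zsmul, singMap_single]
    rfl
  exact DFunLike.congr_fun this x

lemma singMap_singMap {X : Type u} {Y : Type v} {Z : Type w} [TopologicalSpace X]
    [TopologicalSpace Y] [TopologicalSpace Z] (h : C(Y, Z)) (g : C(X, Y)) (n : ℕ)
    (x : SingSimplex X n →₀ ℤ) :
    singMap h n (singMap g n x) = singMap (h.comp g) n x := by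
  simp only [singMap, Finsupp.mapDomain.addMonoidHom_apply, ← Finsupp.mapDomain_comp]
  rfl

lemma singMap_id {X : Type u} [TopologicalSpace X] (n : ℕ) (x : SingSimplex X n →₀ ℤ) :
    singMap (ContinuousMap.id X) n x = x := by
  simp only [singMap, Finsupp.mapDomain.addMonoidHom_apply]
  exact Finsupp.mapDomain_id

/-- The singular chain complex of a space with involution. -/
def singComplex {X : Type u} [TopologicalSpace X] (t : ContInvolution X) : InvComplex.{u} where
  C n := SingSimplex X n →₀ ℤ
  d n := singBoundary X n
  τ n := singMap t.map n
  d_d n x := singBoundary_singBoundary X n x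
  τ_τ n x := by
    rw [singMap_singMap, show t.map.comp t.map = ContinuousMap.id X from
      ContinuousMap.ext t.invol, singMap_id]
  d_τ n x := (singMap_singBoundary t.map n x).symm

/-- A `ℤ/2`-map: a continuous map that commutes with the involutions. -/
structure EquivariantMap {X : Type u} {Y : Type v} [TopologicalSpace X] [TopologicalSpace Y]
    (s : ContInvolution X) (t : ContInvolution Y) where
  /-- the underlying continuous map -/
  map : C(X, Y)
  comm : ∀ x, map (s.map x) = t.map (map x)

/-- The equivariant map of singular chain complexes that is induced by a `ℤ/2`-map. -/
def EquivariantMap.chainMap {X : Type u} {Y : Type v} [TopologicalSpace X] [TopologicalSpace Y]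
    {s : ContInvolution X} {t : ContInvolution Y} (g : EquivariantMap s t) :
    (singComplex s).Hom (singComplex t) where
  f n := singMap g.map n
  map_d n x := singMap_singBoundary g.map n x
  map_τ n x := by
    have h : g.map.comp s.map = t.map.comp g.map := ContinuousMap.ext g.comm
    exact (singMap_singMap g.map s.map n x).trans
      ((congrArg (fun k => singMap k n x) h).trans (singMap_singMap t.map g.map n x).symm)

/-- The infinite-dimensional sphere `S^∞`: the unit sphere of the Hilbert space `ℓ²`. -/
abbrev SphereInf : Type := Metric.sphere (0 : lp (fun _ : ℕ => ℝ) 2) 1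

/-- The antipodal involution of `S^∞`. -/
def antipode : ContInvolution SphereInf where
  map := ⟨fun x => -x, continuous_neg⟩
  invol x := neg_neg x

/-! ### Simplicial complexes and minors -/

section Minors

variable {V : Type u} {W : Type v}

/-- `T` is a missing face of `K`: it is not a face, but all its proper (nonempty) subsets are. -/
def IsMissingFace (K : PreAbstractSimplicialComplex V) (T : Finset V) : Prop :=
  T.Nonempty ∧ T ∉ K ∧ ∀ S : Finset V, S ⊂ T → S.Nonempty → S ∈ K

/-- `K ↦ K'` is an admissible contraction: `K'` is obtained from `K` by identifying a vertex `a`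
with another vertex `b`, and `a` and `b` are not both contained in a missing face of `K` of
dimension at most `dim K`, i.e. in a missing face with at most as many elements as some face
of `K`. -/
def IsAdmissibleContraction [DecidableEq V] (K K' : PreAbstractSimplicialComplex V) : Prop :=
  ∃ a b : V, a ≠ b ∧ {a} ∈ K ∧ {b} ∈ K ∧
    (∀ T : Finset V, IsMissingFace K T → (∃ F ∈ K, T.card ≤ F.card) → ¬ (a ∈ T ∧ b ∈ T)) ∧
    K' = K.map (fun x => if x = a then b else x)

/-- `K ↦ K'` is an admissible contraction or a deletion (that is, `K'` is a subcomplex of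
`K`). -/
def MinorStep [DecidableEq V] (K K' : PreAbstractSimplicialComplex V) : Prop :=
  IsAdmissibleContraction K K' ∨ K' ≤ K

/-- `f` maps the complex `H` isomorphically onto the complex `K`. -/
def IsIsoOnto [DecidableEq V] (f : W → V) (H : PreAbstractSimplicialComplex W)
    (K : PreAbstractSimplicialComplex V) : Prop :=
  Set.InjOn f {x | {x} ∈ H} ∧ H.map f = K

/-- `H < K`: up to isomorphism, `H` can be obtained from `K` by a sequence of admissible
contractions and deletions. -/
def IsMinor [DecidableEq V] (H : PreAbstractSimplicialComplex W)
    (K : PreAbstractSimplicialComplex V) : Prop :=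
  ∃ (K' : PreAbstractSimplicialComplex V) (f : W → V),
    Relation.ReflTransGen MinorStep K K' ∧ IsIsoOnto f H K'

end Minors

/-! ### The deleted product -/

section DeletedProduct

variable {V : Type u} (K : PreAbstractSimplicialComplex V)

/-- `S × T` is a `j`-dimensional cell of the deleted product `K_×`. -/
def IsCell (j : ℕ) (S T : Finset V) : Prop :=
  S ∈ K ∧ T ∈ K ∧ Disjoint S T ∧ S.card + T.card = j + 2

/-- The `j`-dimensional cells of the deleted product `K_×`. -/
abbrev Cell (j : ℕ) : Type u := {c : Finset V × Finset V // IsCell K j c.1 c.2}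

open Classical in
/-- The cellular `j`-chain `S × T`; it is zero if `S × T` is not a `j`-cell of `K_×`. -/
def cell (j : ℕ) (S T : Finset V) : Cell K j →₀ ℤ :=
  if h : IsCell K j S T then Finsupp.single ⟨(S, T), h⟩ 1 else 0

/-- The action `τ (S × T) = (-1) ^ (dim S * dim T) • T × S`. -/
def cellSwap (j : ℕ) : (Cell K j →₀ ℤ) →+ (Cell K j →₀ ℤ) :=
  (Finsupp.linearCombination ℤ fun c : Cell K j =>
    (-1 : ℤ) ^ ((c.1.1.card - 1) * (c.1.2.card - 1)) • cell K j c.1.2 c.1.1).toAddMonoidHom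

variable {K}

lemma IsCell.nonempty {j : ℕ} {S T : Finset V} (h : IsCell K j S T) :
    S.Nonempty ∧ T.Nonempty :=
  ⟨(K.isRelLowerSet_faces h.1).1, (K.isRelLowerSet_faces h.2.1).1⟩

lemma IsCell.symm {j : ℕ} {S T : Finset V} (h : IsCell K j S T) : IsCell K j T S :=
  ⟨h.2.1, h.1, h.2.2.1.symm, by rw [add_comm]; exact h.2.2.2⟩

lemma cell_of_isCell {j : ℕ} {S T : Finset V} (h : IsCell K j S T) :
    cell K j S T = Finsupp.single ⟨(S, T), h⟩ 1 := dif_pos h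

lemma cell_of_not {j : ℕ} {S T : Finset V} (h : ¬ IsCell K j S T) : cell K j S T = 0 := dif_neg h

lemma cell_empty_left (j : ℕ) (T : Finset V) : cell K j ∅ T = 0 :=
  cell_of_not fun h => by simpa using h.nonempty.1

lemma cell_empty_right (j : ℕ) (S : Finset V) : cell K j S ∅ = 0 :=
  cell_of_not fun h => by simpa using h.nonempty.2

lemma cellSwap_cell {j : ℕ} (S T : Finset V) :
    cellSwap K j (cell K j S T)
      = (-1 : ℤ) ^ ((S.card - 1) * (T.card - 1)) • cell K j T S := by
  by_cases h : IsCell K j S T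
  · rw [cell_of_isCell h]
    simp [cellSwap]
  · rw [cell_of_not h, cell_of_not fun h' => h h'.symm]
    simp

lemma cellSwap_cellSwap (j : ℕ) (x : Cell K j →₀ ℤ) : cellSwap K j (cellSwap K j x) = x := by
  have : (cellSwap K j).comp (cellSwap K j) = AddMonoidHom.id _ := by
    apply Finsupp.addHom_ext'
    rintro ⟨⟨S, T⟩, h⟩
    ext1
    simp only [AddMonoidHom.comp_apply, Finsupp.singleAddHom_apply, AddMonoidHom.id_apply]
    rw [← cell_of_isCell h, cellSwap_cell, map_zsmul, cellSwap_cell, smul_smul,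
      mul_comm (T.card - 1), ← mul_pow]
    simp
  exact DFunLike.congr_fun this x

variable [LinearOrder V]

/-- The sign `(-1) ^ |{t ∈ F : t < v}|` of `F \ {v}` in the boundary of the simplex `F` with its
vertices in increasing order. -/
def sgn (v : V) (F : Finset V) : ℤ := (-1) ^ (F.filter (· < v)).card

/-- The chain `∂ (S × T) = ∂ S × T + (-1) ^ dim S • S × ∂ T`, where
`∂ F = ∑ v ∈ F, sgn v F • (F \ {v})`. -/
def cellBd (K : PreAbstractSimplicialComplex V) (j : ℕ) (S T : Finset V) : Cell K j →₀ ℤ :=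
  ∑ v ∈ S, sgn v S • cell K j (S.erase v) T
    + (-1 : ℤ) ^ (S.card - 1) • ∑ v ∈ T, sgn v T • cell K j S (T.erase v)

/-- The boundary map of the cellular chain complex of `K_×`. -/
def cellBoundary (K : PreAbstractSimplicialComplex V) (j : ℕ) : (Cell K (j + 1) →₀ ℤ) →+ (Cell K j →₀ ℤ) :=
  (Finsupp.linearCombination ℤ fun c : Cell K (j + 1) =>
    cellBd K j c.1.1 c.1.2).toAddMonoidHom

lemma cellBoundary_single {j : ℕ} (c : Cell K (j + 1)) :
    cellBoundary K j (Finsupp.single c 1) = cellBd K j c.1.1 c.1.2 := by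
  simp [cellBoundary]

/-- The boundary formula, also for the degenerate products with an empty factor. -/
lemma cellBoundary_cell {j : ℕ} {S T : Finset V} (hS : S = ∅ ∨ S ∈ K) (hT : T = ∅ ∨ T ∈ K)
    (hd : Disjoint S T) (hc : S.card + T.card = j + 3) :
    cellBoundary K j (cell K (j + 1) S T) = cellBd K j S T := by
  rcases hS with rfl | hS
  · simp [cellBd, cell_empty_left]
  rcases hT with rfl | hT
  · simp [cellBd, cell_empty_right]
  have h : IsCell K (j + 1) S T := ⟨hS, hT, hd, hc⟩
  rw [cell_of_isCell h, cellBoundary_single]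

lemma erase_mem {S : Finset V} (hS : S ∈ K) (v : V) : S.erase v = ∅ ∨ S.erase v ∈ K := by
  rcases (S.erase v).eq_empty_or_nonempty with h | h
  · exact Or.inl h
  · exact Or.inr ((K.isRelLowerSet_faces hS).2 (Finset.erase_subset v S) h)

lemma sgn_mul_sgn {S : Finset V} {a b : V} (ha : a ∈ S) (hab : a < b) :
    sgn a S * sgn b (S.erase a) = - (sgn b S * sgn a (S.erase b)) := by
  have h1 : ((S.erase a).filter (· < b)).card + 1 = (S.filter (· < b)).card := by
    rw [Finset.filter_erase]
    exact Finset.card_erase_add_one (by simp [ha, hab])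
  have h2 : (S.erase b).filter (· < a) = S.filter (· < a) := by
    rw [Finset.filter_erase]
    exact Finset.erase_eq_of_notMem (by simp [hab.le])
  simp only [sgn, h2, ← h1]
  ring

/-- `∂ ∂ F = 0` for a simplex, in the form needed below. -/
lemma sum_sgn_sgn {M : Type*} [AddCommGroup M] (S : Finset V) (g : Finset V → M) :
    ∑ v ∈ S, sgn v S • ∑ w ∈ S.erase v, sgn w (S.erase v) • g ((S.erase v).erase w) = 0 := by
  simp only [Finset.smul_sum, smul_smul]
  rw [Finset.sum_sigma']
  refine Finset.sum_involution (fun p _ => ⟨p.2, p.1⟩) ?_ ?_ ?_ ?_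
  · rintro ⟨a, b⟩ h
    simp only [Finset.mem_sigma, Finset.mem_erase] at h
    obtain ⟨ha, hba, hb⟩ := h
    simp only [Finset.erase_right_comm (a := b) (b := a)]
    rw [← add_smul]
    rcases lt_or_gt_of_ne hba with h | h
    · rw [sgn_mul_sgn hb h]; simp
    · rw [sgn_mul_sgn ha h]; simp
  · rintro ⟨a, b⟩ h _ heq
    simp only [Finset.mem_sigma, Finset.mem_erase] at h
    simp only [Sigma.mk.injEq] at heq
    exact h.2.1 heq.1
  · rintro ⟨a, b⟩ h
    simp only [Finset.mem_sigma, Finset.mem_erase] at h ⊢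
    exact ⟨h.2.2, h.2.1.symm, h.1⟩
  · rintro ⟨a, b⟩ h
    rfl

lemma cellBoundary_cellBoundary (j : ℕ) (x : Cell K (j + 2) →₀ ℤ) :
    cellBoundary K j (cellBoundary K (j + 1) x) = 0 := by
  have : (cellBoundary K j).comp (cellBoundary K (j + 1)) = 0 := by
    apply Finsupp.addHom_ext'
    rintro ⟨⟨S, T⟩, h⟩
    ext1
    obtain ⟨hS, hT, hd, hc⟩ : S ∈ K ∧ T ∈ K ∧ Disjoint S T ∧ S.card + T.card = _ := id h
    obtain ⟨hSn, hTn⟩ : S.Nonempty ∧ T.Nonempty := h.nonempty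
    simp only [AddMonoidHom.comp_apply, Finsupp.singleAddHom_apply, cellBoundary_single,
      AddMonoidHom.zero_apply]
    simp only [cellBd, map_add, map_sum, map_zsmul]
    have e1 : ∀ v ∈ S, sgn v S • cellBoundary K j (cell K (j + 1) (S.erase v) T)
        = sgn v S • cellBd K j (S.erase v) T := fun v hv => by
      rw [cellBoundary_cell (erase_mem hS v) (Or.inr hT)
        (hd.mono_left (Finset.erase_subset _ _))
        (by have := Finset.card_erase_add_one hv; omega)]
    have e2 : ∀ v ∈ T, sgn v T • cellBoundary K j (cell K (j + 1) S (T.erase v))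
        = sgn v T • cellBd K j S (T.erase v) := fun v hv => by
      rw [cellBoundary_cell (Or.inr hS) (erase_mem hT v)
        (hd.mono_right (Finset.erase_subset _ _))
        (by have := Finset.card_erase_add_one hv; omega)]
    rw [Finset.sum_congr rfl e1, Finset.sum_congr rfl e2]
    simp only [cellBd, smul_add, Finset.sum_add_distrib]
    rw [sum_sgn_sgn S fun F => cell K j F T]
    have e3 : ∑ v ∈ T, sgn v T • (-1 : ℤ) ^ (S.card - 1) •
        ∑ w ∈ T.erase v, sgn w (T.erase v) • cell K j S ((T.erase v).erase w) = 0 := by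
      have := sum_sgn_sgn T fun F => cell K j S F
      simp only [smul_comm _ ((-1 : ℤ) ^ (S.card - 1)), ← Finset.smul_sum, this, smul_zero]
    rw [e3, zero_add, smul_zero, add_zero]
    simp only [Finset.smul_sum, smul_smul]
    rw [Finset.sum_comm, ← Finset.sum_add_distrib]
    refine Finset.sum_eq_zero fun w hw => ?_
    rw [← Finset.sum_add_distrib]
    refine Finset.sum_eq_zero fun v hv => ?_
    rw [← add_smul]
    have hcard := Finset.card_erase_add_one hv
    rcases Nat.eq_zero_or_pos (S.erase v).card with h0 | h0
    · rw [Finset.card_eq_zero.mp h0, cell_empty_left, smul_zero]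
    · obtain ⟨k, hk⟩ : ∃ k, (S.erase v).card = k + 1 := ⟨_, (Nat.succ_pred_eq_of_pos h0).symm⟩
      rw [hk] at hcard ⊢
      rw [← hcard]
      convert zero_smul ℤ _ using 2
      simp only [Nat.add_sub_cancel]
      ring
  exact DFunLike.congr_fun this x

lemma cellBoundary_cellSwap (j : ℕ) (x : Cell K (j + 1) →₀ ℤ) :
    cellBoundary K j (cellSwap K (j + 1) x) = cellSwap K j (cellBoundary K j x) := by
  have : (cellBoundary K j).comp (cellSwap K (j + 1))
      = (cellSwap K j).comp (cellBoundary K j) := by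
    apply Finsupp.addHom_ext'
    rintro ⟨⟨S, T⟩, h⟩
    ext1
    obtain ⟨hS, hT, hd, hc⟩ : S ∈ K ∧ T ∈ K ∧ Disjoint S T ∧ S.card + T.card = _ := id h
    obtain ⟨hSn, hTn⟩ : S.Nonempty ∧ T.Nonempty := h.nonempty
    simp only [AddMonoidHom.comp_apply, Finsupp.singleAddHom_apply]
    rw [← cell_of_isCell h, cellSwap_cell, map_zsmul,
      cellBoundary_cell (Or.inr hT) (Or.inr hS) hd.symm (by omega),
      cellBoundary_cell (Or.inr hS) (Or.inr hT) hd hc]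
    simp only [cellBd, map_add, map_sum, map_zsmul, cellSwap_cell, smul_add, Finset.smul_sum,
      smul_smul]
    rw [add_comm]
    obtain ⟨s, hs⟩ : ∃ s, S.card = s + 1 := ⟨_, (Nat.succ_pred_eq_of_pos hSn.card_pos).symm⟩
    obtain ⟨t, ht⟩ : ∃ t, T.card = t + 1 := ⟨_, (Nat.succ_pred_eq_of_pos hTn.card_pos).symm⟩
    congr 1
    · refine Finset.sum_congr rfl fun v hv => ?_
      have hcard := Finset.card_erase_add_one hv
      rcases Nat.eq_zero_or_pos (S.erase v).card with h0 | h0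
      · rw [Finset.card_eq_zero.mp h0, cell_empty_right, smul_zero, smul_zero]
      · obtain ⟨k, hk⟩ : ∃ k, (S.erase v).card = k + 1 := ⟨_, (Nat.succ_pred_eq_of_pos h0).symm⟩
        have : s = k + 1 := by omega
        subst this
        rw [hs, ht, hk]
        congr 1
        simp only [Nat.add_sub_cancel]
        have : (-1 : ℤ) ^ t * (-1) ^ t = 1 := by rw [← mul_pow]; simp
        linear_combination (sgn v S * (-1) ^ (k * t)) * this
    · refine Finset.sum_congr rfl fun v hv => ?_
      have hcard := Finset.card_erase_add_one hv
      rcases Nat.eq_zero_or_pos (T.erase v).card with h0 | h0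
      · rw [Finset.card_eq_zero.mp h0, cell_empty_left, smul_zero, smul_zero]
      · obtain ⟨k, hk⟩ : ∃ k, (T.erase v).card = k + 1 := ⟨_, (Nat.succ_pred_eq_of_pos h0).symm⟩
        have : t = k + 1 := by omega
        subst this
        rw [hs, ht, hk]
        congr 1
        simp only [Nat.add_sub_cancel]
        ring
  exact DFunLike.congr_fun this x

variable (K)

/-- The cellular chain complex `C_•(K_×)` of the deleted product with its `ℤ/2`-action. -/
def cellComplex : InvComplex.{u} where
  C j := Cell K j →₀ ℤ
  d j := cellBoundary K j
  τ j := cellSwap K j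
  d_d j x := cellBoundary_cellBoundary j x
  τ_τ j x := cellSwap_cellSwap j x
  d_τ j x := cellBoundary_cellSwap j x

end DeletedProduct

/-! ### The geometric realization of the deleted product and the Van Kampen obstruction -/

section Obstruction

variable {V : Type u}

/-- The geometric simplex `|S| ⊆ ℝ^V` with vertex set `S`, in barycentric coordinates. -/
def geomSimplex (S : Finset V) : Set (V → ℝ) :=
  {x | (∀ v, 0 ≤ x v) ∧ (∀ v, v ∉ S → x v = 0) ∧ ∑ v ∈ S, x v = 1}

/-- The space `|K_×|`, the union of the cells `|S| × |T|` over disjoint faces `S`, `T` of `K`. -/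
def realization (K : PreAbstractSimplicialComplex V) : Set ((V → ℝ) × (V → ℝ)) :=
  {p | ∃ S ∈ K, ∃ T ∈ K, Disjoint S T ∧ p.1 ∈ geomSimplex S ∧ p.2 ∈ geomSimplex T}

lemma swap_mem_realization {K : PreAbstractSimplicialComplex V} {p : (V → ℝ) × (V → ℝ)}
    (hp : p ∈ realization K) : p.swap ∈ realization K := by
  obtain ⟨S, hS, T, hT, hd, h1, h2⟩ := hp
  exact ⟨T, hT, S, hS, hd.symm, h2, h1⟩

/-- The involution `(x, y) ↦ (y, x)` of `|K_×|`. -/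
def realizationSwap (K : PreAbstractSimplicialComplex V) : ContInvolution (realization K) where
  map := ⟨fun p => ⟨p.1.swap, swap_mem_realization p.2⟩, by fun_prop⟩
  invol _ := rfl

/-- A comparison map from cellular to singular chains of `|K_×|`: an equivariant chain map that
maps each cell `S × T` to a singular chain of `|S| × |T|`, and each vertex to the singular
`0`-simplex at this vertex. By the method of acyclic carriers it exists (barycentric subdivision
is an example) and it is unique up to equivariant chain homotopy. -/
structure Comparison [LinearOrder V] (K : PreAbstractSimplicialComplex V) where
  /-- the chain map -/
  hom : (cellComplex K).Hom (singComplex (realizationSwap K))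
  carrier : ∀ (n : ℕ) (c : Cell K n) (σ : SingSimplex (realization K) n),
    σ ∈ (show SingSimplex (realization K) n →₀ ℤ from hom.f n (Finsupp.single c (1 : ℤ))).support →
      ∀ t, ((σ t : realization K) : (V → ℝ) × (V → ℝ)) ∈
        geomSimplex c.1.1 ×ˢ geomSimplex c.1.2
  vertex : ∀ c : Cell K 0,
    (show SingSimplex (realization K) 0 →₀ ℤ from hom.f 0 (Finsupp.single c (1 : ℤ))).sum
      (fun _ a => a) = 1

/-- The homomorphism `i^* : H_eq^m(S^∞) → H_eq^m(K_×)` that is induced by a `ℤ/2`-map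
`i : |K_×| → S^∞`; it is computed on cellular chains with a comparison map. -/
def inducedMap [LinearOrder V] {K : PreAbstractSimplicialComplex V} (η : Comparison K)
    (i : EquivariantMap (realizationSwap K) antipode) (m : ℕ) :
    (singComplex antipode).Heq m →+ (cellComplex K).Heq m :=
  (i.chainMap.comp η.hom).pullback m

/-- `o ∈ H_eq^m(K_×)` is the Van Kampen obstruction `o^m(K_×)`: it is `i^* z` for a `ℤ/2`-map
`i : |K_×| → S^∞` and a generator `z` of `H_eq^m(S^∞)`. This determines `o` up to sign. -/
def IsVanKampenObstruction [LinearOrder V] (K : PreAbstractSimplicialComplex V) (m : ℕ)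
    (o : (cellComplex K).Heq m) : Prop :=
  ∃ (η : Comparison K) (i : EquivariantMap (realizationSwap K) antipode)
    (z : (singComplex antipode).Heq m),
    AddSubgroup.zmultiples z = ⊤ ∧ o = inducedMap η i m z

end Obstruction

end VanKampen

end

noncomputable section

namespace VanKampen

universe u v w

/-! ### Augmented simplicial chains -/

section SimplicialChains

variable {V : Type u} [LinearOrder V] {W : Type v} [LinearOrder W]

/-! The obstruction depends only on the cellular chains of the deleted product, with their
involution and augmentation. Since `S^∞` is acyclic and the involution permutes the cells of `H_×`
freely up to sign, any two equivariant chain maps `C_•(H_×) → C_•(S^∞)` with the same augmentation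
are equivariantly homotopic, so they agree on `H_eq^m` (`pullback_eq_of_coeffSum_eq`). It therefore
suffices to construct an augmentation-preserving equivariant chain map `g : C_•(H_×) → C_•(K_×)`:
then `i_H^* = g^* ∘ i_K^*`, and if `i_K^*` kills a generator of `H_eq^m(S^∞)`, then `i_H^*`
vanishes.

The map `g` is composed from one map for each step of the minor (`DeletedProductMap.of_isMinor`).
Subcomplexes and isomorphisms are clear. An admissible contraction of `a` to `b` requires a chain
map `φ` from the contraction `K'` back to `K` that keeps disjoint faces disjoint; then `S × T ↦ φ S
× φ T` works. It is built by acyclic carriers: `φ S` is a cone over `φ (∂S)`, supported on `S`, or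
on `S ∪ {a}` if `b ∈ S`. Admissibility provides exactly the faces of dimension at most `dim S` that
the cone requires (`insert_insert_mem`). Disjointness survives because `a` is not a vertex of `K'`
and at most one of two disjoint faces contains `b`.

The acyclicity of `S^∞` is proved by an explicit cone on singular simplices, modelled on the
contraction of the unit sphere of `ℓ²` by the shift. -/

lemma linearMap_eq_of_support {α : Type*} {M : Type*} [AddCommGroup M]
    {L L' : (α →₀ ℤ) →ₗ[ℤ] M} (x : α →₀ ℤ)
    (h : ∀ a ∈ x.support, L (Finsupp.single a 1) = L' (Finsupp.single a 1)) : L x = L' x := by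
  have hx : x = ∑ a ∈ x.support, x a • Finsupp.single a (1 : ℤ) := by
    conv_lhs => rw [← Finsupp.sum_single x]
    simp [Finsupp.sum]
  rw [hx, map_sum, map_sum]
  exact Finset.sum_congr rfl fun a ha => by rw [map_smul, map_smul, h a ha]

/-- The augmented boundary map of the full simplex with vertex set `V`. -/
def simpBd (V : Type u) [LinearOrder V] : (Finset V →₀ ℤ) →ₗ[ℤ] (Finset V →₀ ℤ) :=
  Finsupp.linearCombination ℤ fun S => ∑ v ∈ S, sgn v S • Finsupp.single (S.erase v) 1

lemma simpBd_single (S : Finset V) :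
    simpBd V (Finsupp.single S 1) = ∑ v ∈ S, sgn v S • Finsupp.single (S.erase v) 1 := by
  simp [simpBd]

/-- The cone operator with apex `a`. -/
def simpCone (a : V) : (Finset V →₀ ℤ) →ₗ[ℤ] (Finset V →₀ ℤ) :=
  Finsupp.linearCombination ℤ fun S =>
    if a ∈ S then 0 else sgn a (insert a S) • Finsupp.single (insert a S) 1

lemma simpCone_single_of_mem {a : V} {S : Finset V} (h : a ∈ S) :
    simpCone a (Finsupp.single S 1) = 0 := by
  simp [simpCone, h]

lemma simpCone_single_of_notMem {a : V} {S : Finset V} (h : a ∉ S) :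
    simpCone a (Finsupp.single S 1) = sgn a (insert a S) • Finsupp.single (insert a S) 1 := by
  simp [simpCone, h]

lemma sgn_singleton (v : V) : sgn v {v} = 1 := by
  simp [sgn, Finset.filter_singleton]

lemma sgn_mul_self (v : V) (S : Finset V) : sgn v S * sgn v S = 1 := by
  simp [sgn, ← mul_pow]

lemma sgn_mul_sgn_of_ne {S : Finset V} {a b : V} (ha : a ∈ S) (hb : b ∈ S) (hab : a ≠ b) :
    sgn a S * sgn b (S.erase a) = - (sgn b S * sgn a (S.erase b)) := by
  rcases lt_or_gt_of_ne hab with h | h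
  · exact sgn_mul_sgn ha h
  · rw [sgn_mul_sgn hb h, neg_neg]

/-- Because the empty simplex is a generator, the cone formula needs no correction in low degrees.
If `a ∈ S`, only the facet opposite `a` can be coned, and this gives back `S`. If `a ∉ S`, deleting
`a` from the cone gives `S`, and the other terms cancel since deletions of two vertices anticommute.
-/
lemma simpBd_simpCone (a : V) (x : Finset V →₀ ℤ) :
    simpBd V (simpCone a x) = x - simpCone a (simpBd V x) := by
  suffices h : (simpBd V) ∘ₗ (simpCone a) = LinearMap.id - (simpCone a) ∘ₗ (simpBd V) from
    DFunLike.congr_fun h x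
  refine Finsupp.lhom_ext' fun S => LinearMap.ext_ring ?_
  simp only [LinearMap.comp_apply, Finsupp.lsingle_apply, LinearMap.sub_apply, LinearMap.id_apply,
    simpBd_single, map_sum, map_smul]
  by_cases ha : a ∈ S
  · rw [simpCone_single_of_mem ha, map_zero, Finset.sum_eq_single a]
    · rw [simpCone_single_of_notMem (Finset.notMem_erase a S), Finset.insert_erase ha, smul_smul,
        sgn_mul_self, one_smul, sub_self]
    · intro v _ hva
      rw [simpCone_single_of_mem (Finset.mem_erase.2 ⟨hva.symm, ha⟩), smul_zero]
    · exact fun h => absurd ha h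
  · rw [simpCone_single_of_notMem ha, map_smul, simpBd_single, Finset.sum_insert ha,
      Finset.erase_insert ha, smul_add, smul_smul, sgn_mul_self, one_smul, sub_eq_add_neg,
      Finset.smul_sum, ← Finset.sum_neg_distrib]
    congr 1
    refine Finset.sum_congr rfl fun v hv => ?_
    have hva : a ≠ v := fun h => ha (h ▸ hv)
    rw [simpCone_single_of_notMem (fun h => ha (Finset.mem_of_mem_erase h)),
      Finset.erase_insert_of_ne hva, smul_smul, smul_smul, ← neg_smul]
    congr 1
    have h := sgn_mul_sgn_of_ne (Finset.mem_insert_self a S) (Finset.mem_insert_of_mem hv) hva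
    rw [Finset.erase_insert ha, Finset.erase_insert_of_ne hva] at h
    have h1 := sgn_mul_self a (insert a S)
    have h2 := sgn_mul_self a (insert a (S.erase v))
    linear_combination sgn a (insert a S) * sgn a (insert a (S.erase v)) * h
      - sgn a (insert a S) * sgn v (insert a S) * h2 - sgn v S * sgn a (insert a (S.erase v)) * h1

/-- The chain map that is built from the cones with the apices `apex S`. -/
def coneMap (apex : Finset W → V) (S : Finset W) : Finset V →₀ ℤ :=
  if S = ∅ then Finsupp.single ∅ 1 else
    ∑ v ∈ S.attach, sgn v.1 S • simpCone (apex S) (coneMap apex (S.erase v.1))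
termination_by S.card
decreasing_by exact Finset.card_erase_lt_of_mem v.2

lemma coneMap_empty (apex : Finset W → V) : coneMap apex ∅ = Finsupp.single ∅ 1 := by
  rw [coneMap, if_pos rfl]

lemma coneMap_of_ne_empty (apex : Finset W → V) {S : Finset W} (hS : S ≠ ∅) :
    coneMap apex S = ∑ v ∈ S, sgn v S • simpCone (apex S) (coneMap apex (S.erase v)) := by
  rw [coneMap, if_neg hS,
    Finset.sum_attach S fun v => sgn v S • simpCone (apex S) (coneMap apex (S.erase v))]

/-- `coneMap` is a chain map for any choice of apices: by induction the cone formula leaves as error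
term the cone over the image of `∂∂S`, which is zero. -/
lemma simpBd_coneMap (apex : Finset W → V) (S : Finset W) :
    simpBd V (coneMap apex S) = ∑ v ∈ S, sgn v S • coneMap apex (S.erase v) := by
  induction hn : S.card generalizing S with
  | zero =>
    obtain rfl := Finset.card_eq_zero.1 hn
    simp [coneMap_empty, simpBd_single]
  | succ n ih =>
    have hS : S ≠ ∅ := by rintro rfl; simp at hn
    rw [coneMap_of_ne_empty apex hS, map_sum]
    simp only [map_smul, simpBd_simpCone, smul_sub, Finset.sum_sub_distrib]
    rw [sub_eq_self]
    have h : ∀ v ∈ S, sgn v S • simpCone (apex S) (simpBd V (coneMap apex (S.erase v)))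
        = simpCone (apex S)
          (sgn v S • ∑ w ∈ S.erase v, sgn w (S.erase v) • coneMap apex ((S.erase v).erase w)) :=
      fun v hv => by
        rw [ih _ (by rw [Finset.card_erase_of_mem hv, hn, Nat.add_sub_cancel]), map_smul]
    rw [Finset.sum_congr rfl h, ← map_sum, sum_sgn_sgn S (coneMap apex), map_zero]

lemma exists_of_mem_support_simpCone {a : V} {x : Finset V →₀ ℤ} {F : Finset V}
    (hF : F ∈ (simpCone a x).support) : ∃ G ∈ x.support, a ∉ G ∧ F = insert a G := by
  rw [simpCone, Finsupp.linearCombination_apply] at hF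
  obtain ⟨G, hG, hFG⟩ := Finset.mem_biUnion.1 (Finsupp.support_sum hF)
  refine ⟨G, hG, ?_⟩
  by_cases ha : a ∈ G
  · simp [ha] at hFG
  · refine ⟨ha, ?_⟩
    rw [if_neg ha] at hFG
    have := Finsupp.support_smul (Finsupp.support_smul hFG)
    exact Finset.mem_singleton.1 (Finsupp.support_single_subset this)

/-- The chains `coneMap apex S` are carried by `P` if every `P S` is closed under coning with
apex `apex S` below the dimension of `S`. -/
lemma mem_of_mem_support_coneMap {apex : Finset W → V} {P : Finset W → Finset V → Prop}
    {D : Set (Finset W)} (hD : ∀ S ∈ D, ∀ v, S.erase v ∈ D) (hempty : P ∅ ∅)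
    (hmono : ∀ S ∈ D, ∀ v F, P (S.erase v) F → P S F)
    (hcone : ∀ S ∈ D, S.Nonempty → ∀ F, P S F → F.card < S.card → P S (insert (apex S) F))
    {S : Finset W} (hS : S ∈ D) {F : Finset V} (hF : F ∈ (coneMap apex S).support) :
    P S F ∧ F.card = S.card := by
  induction hn : S.card generalizing S F with
  | zero =>
    obtain rfl := Finset.card_eq_zero.1 hn
    rw [coneMap_empty] at hF
    obtain rfl := Finset.mem_singleton.1 (Finsupp.support_single_subset hF)
    exact ⟨hempty, rfl⟩
  | succ n ih =>
    have hS0 : S ≠ ∅ := by rintro rfl; simp at hn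
    rw [coneMap_of_ne_empty apex hS0] at hF
    obtain ⟨v, hv, hFv⟩ := Finset.mem_biUnion.1 (Finsupp.support_finsetSum hF)
    obtain ⟨G, hG, ha, rfl⟩ := exists_of_mem_support_simpCone (Finsupp.support_smul hFv)
    -- `G` comes from a facet of `S`, so it has one vertex fewer than `S`; this is why the cone
    -- condition is only required below the cardinality of `S`.
    obtain ⟨h1, h2⟩ := ih (hD S hS v) hG (by rw [Finset.card_erase_of_mem hv, hn]; rfl)
    refine ⟨hcone S hS (Finset.nonempty_iff_ne_empty.2 hS0) G (hmono S hS v G h1) (by omega), ?_⟩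
    rw [Finset.card_insert_of_notMem ha, h2]

/-! ### Products of chains -/

/-- The cellular chain `x × y` of the deleted product. -/
def cellProd (K : PreAbstractSimplicialComplex V) (j : ℕ) :
    (Finset V →₀ ℤ) →ₗ[ℤ] (Finset V →₀ ℤ) →ₗ[ℤ] (Cell K j →₀ ℤ) :=
  Finsupp.linearCombination ℤ fun F => Finsupp.linearCombination ℤ fun G => cell K j F G

omit [LinearOrder V] in
lemma cellProd_single (K : PreAbstractSimplicialComplex V) (j : ℕ) (F G : Finset V) :
    cellProd K j (Finsupp.single F 1) (Finsupp.single G 1) = cell K j F G := by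
  simp [cellProd]

lemma bilinear_eq_of_support {α β : Type*} {M : Type*} [AddCommGroup M]
    {L L' : (α →₀ ℤ) →ₗ[ℤ] (β →₀ ℤ) →ₗ[ℤ] M} (x : α →₀ ℤ) (y : β →₀ ℤ)
    (h : ∀ a ∈ x.support, ∀ b ∈ y.support, L (Finsupp.single a 1) (Finsupp.single b 1)
      = L' (Finsupp.single a 1) (Finsupp.single b 1)) : L x y = L' x y := by
  change L.flip y x = L'.flip y x
  exact linearMap_eq_of_support x fun a ha => linearMap_eq_of_support y fun b hb => h a ha b hb

/-- The Leibniz rule passes from cells to chains by bilinearity. A common cardinality `s` in the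
first factor is needed to pull out one sign. -/
lemma cellBoundary_cellProd {K : PreAbstractSimplicialComplex V} {j s : ℕ}
    (x y : Finset V →₀ ℤ)
    (h : ∀ F ∈ x.support, ∀ G ∈ y.support,
      F ∈ K ∧ G ∈ K ∧ Disjoint F G ∧ F.card = s ∧ F.card + G.card = j + 3) :
    cellBoundary K j (cellProd K (j + 1) x y)
      = cellProd K j (simpBd V x) y + (-1 : ℤ) ^ (s - 1) • cellProd K j x (simpBd V y) := by
  refine bilinear_eq_of_support
    (L := (cellProd K (j + 1)).compr₂ (cellBoundary K j).toIntLinearMap)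
    (L' := (cellProd K j) ∘ₗ simpBd V + (-1 : ℤ) ^ (s - 1) • (cellProd K j).compl₂ (simpBd V))
    x y fun F hF G hG => ?_
  obtain ⟨hFK, hGK, hd, hs, hc⟩ := h F hF G hG
  simp only [LinearMap.compr₂_apply, LinearMap.add_apply, LinearMap.smul_apply,
    LinearMap.comp_apply, LinearMap.compl₂_apply, cellProd_single, simpBd_single, map_sum,
    map_smul, LinearMap.sum_apply]
  change cellBoundary K j _ = _
  rw [cellBoundary_cell (Or.inr hFK) (Or.inr hGK) hd hc, cellBd, hs]

omit [LinearOrder V] in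
lemma cellSwap_cellProd {K : PreAbstractSimplicialComplex V} {j s t : ℕ}
    (x y : Finset V →₀ ℤ) (hx : ∀ F ∈ x.support, F.card = s) (hy : ∀ F ∈ y.support, F.card = t) :
    cellSwap K j (cellProd K j x y) = (-1 : ℤ) ^ ((s - 1) * (t - 1)) • cellProd K j y x := by
  refine bilinear_eq_of_support
    (L := (cellProd K j).compr₂ (cellSwap K j).toIntLinearMap)
    (L' := (-1 : ℤ) ^ ((s - 1) * (t - 1)) • (cellProd K j).flip)
    x y fun F hF G hG => ?_
  simp only [LinearMap.compr₂_apply, LinearMap.smul_apply, LinearMap.flip_apply, cellProd_single]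
  change cellSwap K j _ = _
  rw [cellSwap_cell, hx F hF, hy G hG]

/-- The sum of the coefficients of a chain. -/
def coeffSum (α : Type*) : (α →₀ ℤ) →ₗ[ℤ] ℤ := Finsupp.linearCombination ℤ fun _ => (1 : ℤ)

lemma coeffSum_apply {α : Type*} (x : α →₀ ℤ) : coeffSum α x = x.sum fun _ a => a := by
  simp [coeffSum, Finsupp.linearCombination_apply]

lemma coeffSum_single {α : Type*} (a : α) : coeffSum α (Finsupp.single a 1) = 1 := by
  simp [coeffSum]

omit [LinearOrder V] in
lemma coeffSum_cellProd {K : PreAbstractSimplicialComplex V} (x y : Finset V →₀ ℤ)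
    (h : ∀ F ∈ x.support, ∀ G ∈ y.support, IsCell K 0 F G) :
    coeffSum _ (cellProd K 0 x y) = coeffSum _ x * coeffSum _ y := by
  refine bilinear_eq_of_support
    (L := (cellProd K 0).compr₂ (coeffSum _))
    (L' := (LinearMap.mul ℤ ℤ).compl₁₂ (coeffSum _) (coeffSum _))
    x y fun F hF G hG => ?_
  simp [cellProd_single, cell_of_isCell (h F hF G hG), coeffSum_single]

/-! ### Equivariant chain maps of deleted products -/

/-- There is an augmentation-preserving equivariant chain map `C_•(H_×) → C_•(K_×)`. -/
def DeletedProductMap (H : PreAbstractSimplicialComplex W) (K : PreAbstractSimplicialComplex V) :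
    Prop :=
  ∃ g : (cellComplex H).Hom (cellComplex K),
    ∀ c : Cell H 0, coeffSum (Cell K 0) (g.f 0 (Finsupp.single c (1 : ℤ))) = 1

lemma sum_coeff_preserved {α β : Type*} {f : (α →₀ ℤ) →+ (β →₀ ℤ)}
    (h : ∀ c, coeffSum β (f (Finsupp.single c 1)) = 1) (x : α →₀ ℤ) :
    coeffSum β (f x) = coeffSum α x :=
  linearMap_eq_of_support (L := coeffSum β ∘ₗ f.toIntLinearMap) x fun a _ =>
    (h a).trans (coeffSum_single a).symm

lemma DeletedProductMap.trans {U : Type w} [LinearOrder U] {G : PreAbstractSimplicialComplex U}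
    {H : PreAbstractSimplicialComplex W} {K : PreAbstractSimplicialComplex V}
    (h₁ : DeletedProductMap G H) (h₂ : DeletedProductMap H K) : DeletedProductMap G K := by
  obtain ⟨f, hf⟩ := h₁
  obtain ⟨g, hg⟩ := h₂
  refine ⟨g.comp f, fun c => ?_⟩
  exact (sum_coeff_preserved (f := g.f 0) hg _).trans (hf c)

/-- A chain map of simplicial chains that maps disjoint faces to chains with disjoint supports
induces a map of deleted products. -/
lemma DeletedProductMap.of_chainMap {H : PreAbstractSimplicialComplex W}
    {K : PreAbstractSimplicialComplex V} (φ : Finset W → Finset V →₀ ℤ)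
    (hempty : φ ∅ = Finsupp.single ∅ 1)
    (hbd : ∀ S, simpBd V (φ S) = ∑ v ∈ S, sgn v S • φ (S.erase v))
    (hφ : ∀ S ∈ H, ∀ F ∈ (φ S).support, F ∈ K ∧ F.card = S.card)
    (hdisj : ∀ S ∈ H, ∀ T ∈ H, Disjoint S T → ∀ F ∈ (φ S).support, ∀ G ∈ (φ T).support,
      Disjoint F G) : DeletedProductMap H K := by
  let g : ∀ j, (Cell H j →₀ ℤ) →+ (Cell K j →₀ ℤ) := fun j =>
    (Finsupp.linearCombination ℤ fun c : Cell H j =>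
      cellProd K j (φ c.1.1) (φ c.1.2)).toAddMonoidHom
  have gs : ∀ j (c : Cell H j), g j (Finsupp.single c 1) = cellProd K j (φ c.1.1) (φ c.1.2) :=
    fun j c => by simp [g]
  -- Empty factors must be allowed, since deleting the last vertex of a factor produces them in the
  -- boundary. As `φ ∅` is the empty simplex, both sides are then zero.
  have gcell : ∀ j (S T : Finset W), (S = ∅ ∨ S ∈ H) → (T = ∅ ∨ T ∈ H) → Disjoint S T →
      S.card + T.card = j + 2 → g j (cell H j S T) = cellProd K j (φ S) (φ T) := by
    intro j S T hS hT hd hc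
    rcases hS with rfl | hS
    · rw [cell_empty_left, map_zero, hempty, eq_comm]
      exact linearMap_eq_of_support (L' := 0) (φ T) fun G _ => by
        rw [cellProd_single, cell_empty_left, LinearMap.zero_apply]
    rcases hT with rfl | hT
    · rw [cell_empty_right, map_zero, hempty, eq_comm]
      exact linearMap_eq_of_support (L := (cellProd K j).flip (Finsupp.single ∅ 1)) (L' := 0)
        (φ S) fun G _ => by
          rw [LinearMap.flip_apply, cellProd_single, cell_empty_right, LinearMap.zero_apply]
    rw [cell_of_isCell ⟨hS, hT, hd, hc⟩, gs]
  have hcells : ∀ j (c : Cell H j), ∀ F ∈ (φ c.1.1).support, ∀ G ∈ (φ c.1.2).support,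
      IsCell K j F G ∧ F.card = c.1.1.card := by
    intro j c F hF G hG
    obtain ⟨hS, hT, hd, hc⟩ := c.2
    have h1 := hφ _ hS F hF
    have h2 := hφ _ hT G hG
    exact ⟨⟨h1.1, h2.1, hdisj _ hS _ hT hd F hF G hG, by rw [h1.2, h2.2, hc]⟩, h1.2⟩
  have hd : ∀ j, (g j).comp (cellBoundary H j) = (cellBoundary K j).comp (g (j + 1)) := by
    intro j
    apply Finsupp.addHom_ext'
    intro c
    ext1
    obtain ⟨hS, hT, hd, hc⟩ := c.2
    simp only [AddMonoidHom.comp_apply, Finsupp.singleAddHom_apply, cellBoundary_single, gs]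
    rw [cellBoundary_cellProd (s := c.1.1.card) _ _ fun F hF G hG => ?_]
    · simp only [cellBd, map_add, map_sum, map_zsmul, hbd, map_smul, LinearMap.sum_apply,
        LinearMap.smul_apply]
      congr 1
      · refine Finset.sum_congr rfl fun v hv => ?_
        rw [gcell j _ _ (erase_mem hS v) (Or.inr hT) (hd.mono_left (Finset.erase_subset _ _))
          (by have := Finset.card_erase_add_one hv; omega)]
      · congr 1
        refine Finset.sum_congr rfl fun v hv => ?_
        rw [gcell j _ _ (Or.inr hS) (erase_mem hT v) (hd.mono_right (Finset.erase_subset _ _))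
          (by have := Finset.card_erase_add_one hv; omega)]
    · obtain ⟨h1, h2⟩ := hcells (j + 1) c F hF G hG
      exact ⟨h1.1, h1.2.1, h1.2.2.1, h2, h1.2.2.2⟩
  have hτ : ∀ j, (g j).comp (cellSwap H j) = (cellSwap K j).comp (g j) := by
    intro j
    apply Finsupp.addHom_ext'
    intro c
    ext1
    obtain ⟨hS, hT, hd, hc⟩ := c.2
    simp only [AddMonoidHom.comp_apply, Finsupp.singleAddHom_apply, gs]
    rw [cellSwap_cellProd _ _ (fun F hF => (hφ _ hS F hF).2) (fun F hF => (hφ _ hT F hF).2),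
      ← cell_of_isCell c.2, cellSwap_cell, map_zsmul,
      gcell j _ _ (Or.inr hT) (Or.inr hS) hd.symm (by omega)]
  refine ⟨⟨g, fun j x => DFunLike.congr_fun (hd j) x, fun j x => DFunLike.congr_fun (hτ j) x⟩,
    fun c => ?_⟩
  change coeffSum _ (g 0 (Finsupp.single c 1)) = 1
  obtain ⟨hS, hT, hd, hc⟩ := c.2
  have hcard : c.1.1.card = 1 ∧ c.1.2.card = 1 := by
    have h1 := (H.isRelLowerSet_faces hS).1.card_pos
    have h2 := (H.isRelLowerSet_faces hT).1.card_pos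
    omega
  -- The augmentation is already encoded in the boundary: on chains of vertices `simpBd` is the
  -- coefficient sum times the empty simplex, while `hbd` and `hempty` make the boundary of `φ {w}`
  -- the empty simplex itself.
  have haug : ∀ S ∈ H, S.card = 1 → coeffSum _ (φ S) = 1 := by
    intro S hS h1
    have e : simpBd V (φ S) = (coeffSum _).smulRight (Finsupp.single (∅ : Finset V) (1 : ℤ)) (φ S) :=
      linearMap_eq_of_support _ fun F hF => by
        obtain ⟨v, rfl⟩ := Finset.card_eq_one.1 ((hφ S hS F hF).2.trans h1)
        simp [simpBd_single, coeffSum_single, sgn_singleton]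
    obtain ⟨w, rfl⟩ := Finset.card_eq_one.1 h1
    rw [hbd] at e
    have := congrArg (fun x => x (∅ : Finset V)) e
    simpa [hempty, sgn_singleton] using this.symm
  rw [gs, coeffSum_cellProd _ _ fun F hF G hG => (hcells 0 c F hF G hG).1, haug _ hS hcard.1,
    haug _ hT hcard.2, one_mul]

end SimplicialChains

/-! ### Minors and deleted products -/

section Minors

variable {V : Type u} [LinearOrder V] {W : Type v} [LinearOrder W]

/-- The induced map of deleted products, with chains that are carried by `P`. -/
lemma DeletedProductMap.of_carrier {H : PreAbstractSimplicialComplex W}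
    {K : PreAbstractSimplicialComplex V} (apex : Finset W → V) (P : Finset W → Set V)
    (hmono : Monotone P)
    (hcone : ∀ S ∈ H, ∀ F : Finset V, (F = ∅ ∨ F ∈ K) → ↑F ⊆ P S → F.card < S.card →
      insert (apex S) F ∈ K ∧ apex S ∈ P S)
    (hdisj : ∀ S ∈ H, ∀ T ∈ H, Disjoint S T → Disjoint (P S) (P T)) :
    DeletedProductMap H K := by
  have key : ∀ S, (S = ∅ ∨ S ∈ H) → ∀ F ∈ (coneMap apex S).support,
      ((F = ∅ ∨ F ∈ K) ∧ (F : Set V) ⊆ P S) ∧ F.card = S.card := by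
    intro S hS F hF
    refine mem_of_mem_support_coneMap (D := {S | S = ∅ ∨ S ∈ H})
      (P := fun S F => (F = ∅ ∨ F ∈ K) ∧ (F : Set V) ⊆ P S) ?_ ?_ ?_ ?_ hS hF
    · rintro S (rfl | hS) v
      · exact Or.inl rfl
      · exact erase_mem hS v
    · exact ⟨Or.inl rfl, by simp⟩
    · exact fun S _ v F hF => ⟨hF.1, hF.2.trans (hmono (Finset.erase_subset v S))⟩
    · rintro S (rfl | hS) hne F ⟨hF, hFP⟩ hc
      · simp at hne
      · obtain ⟨h1, h2⟩ := hcone S hS F hF hFP hc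
        refine ⟨Or.inr h1, ?_⟩
        rw [Finset.coe_insert]
        exact Set.insert_subset h2 hFP
  refine .of_chainMap (coneMap apex) (coneMap_empty apex) (simpBd_coneMap apex) ?_ ?_
  · intro S hS F hF
    obtain ⟨⟨h1, -⟩, h2⟩ := key S (Or.inr hS) F hF
    refine ⟨h1.resolve_left ?_, h2⟩
    rintro rfl
    have := (H.isRelLowerSet_faces hS).1.card_pos
    rw [← h2] at this
    simp at this
  · intro S hS T hT hd F hF G hG
    rw [← Finset.disjoint_coe]
    exact (hdisj S hS T hT hd).mono (key S (Or.inr hS) F hF).1.2 (key T (Or.inr hT) G hG).1.2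

/-- A simplicial map that is injective on the vertices induces a map of deleted products. -/
lemma DeletedProductMap.of_injOn {H : PreAbstractSimplicialComplex W}
    {K : PreAbstractSimplicialComplex V} (f : W → V) (hf : Set.InjOn f {x | {x} ∈ H})
    (hHK : ∀ S ∈ H, S.image f ∈ K) : DeletedProductMap H K := by
  classical
  rcases isEmpty_or_nonempty W with hW | ⟨⟨w⟩⟩
  · have hH : ∀ S, S ∉ H := fun S hS =>
      (H.isRelLowerSet_faces hS).1.ne_empty (Finset.eq_empty_of_isEmpty S)
    exact .of_chainMap (fun _ => Finsupp.single ∅ 1) rfl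
      (fun S => by simp [simpBd_single, Finset.eq_empty_of_isEmpty S])
      (fun S hS => absurd hS (hH S)) (fun S hS => absurd hS (hH S))
  have hvert : ∀ S ∈ H, (S : Set W) ⊆ {x | {x} ∈ H} := fun S hS x hx =>
    (H.isRelLowerSet_faces hS).2 (Finset.singleton_subset_iff.2 hx) (Finset.singleton_nonempty x)
  -- Every nonempty subset of the image of `S` is a face of `K`, so any vertex of that image can be
  -- the apex. The default `w` only serves `S = ∅`.
  refine .of_carrier (fun S => f (if h : S.Nonempty then h.choose else w))
    (fun S => f '' S) (fun S T h => Set.image_mono (Finset.coe_subset.2 h)) ?_ ?_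
  · intro S hS F _ hFS _
    have hne := (H.isRelLowerSet_faces hS).1
    have h1 : f (if h : S.Nonempty then h.choose else w) ∈ f '' (S : Set W) := by
      rw [dif_pos hne]
      exact ⟨_, hne.choose_spec, rfl⟩
    refine ⟨(K.isRelLowerSet_faces (hHK S hS)).2 ?_ (Finset.insert_nonempty _ _), h1⟩
    rw [← Finset.coe_subset, Finset.coe_insert, Finset.coe_image]
    exact Set.insert_subset h1 hFS
  · intro S hS T hT hd
    rw [Set.disjoint_left]
    rintro _ ⟨x, hx, rfl⟩ ⟨y, hy, hxy⟩
    obtain rfl := hf (hvert T hT hy) (hvert S hS hx) hxy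
    exact Finset.disjoint_left.1 hd hx hy

lemma DeletedProductMap.of_le {K K' : PreAbstractSimplicialComplex V} (h : K' ≤ K) :
    DeletedProductMap K' K :=
  .of_injOn id (Function.injective_id.injOn) fun S hS => by rw [Finset.image_id]; exact h hS

lemma DeletedProductMap.refl (K : PreAbstractSimplicialComplex V) : DeletedProductMap K K :=
  .of_le le_rfl

omit [LinearOrder V] in
/-- A non-face contains a missing face. -/
lemma exists_isMissingFace (K : PreAbstractSimplicialComplex V) {T : Finset V}
    (hT : T.Nonempty) (hTK : T ∉ K) : ∃ M ⊆ T, IsMissingFace K M := by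
  induction T using Finset.strongInduction with
  | H T ih =>
    by_cases h : ∀ S : Finset V, S ⊂ T → S.Nonempty → S ∈ K
    · exact ⟨T, subset_rfl, hT, hTK, h⟩
    · push Not at h
      obtain ⟨S, hST, hS, hSK⟩ := h
      obtain ⟨M, hM, h⟩ := ih S hST hS hSK
      exact ⟨M, hM.trans hST.subset, h⟩

/-- If `a` and `b` are not both contained in a small missing face, and `F ∪ {a}` and `F ∪ {b}`
are faces, then so is `F ∪ {a, b}` as long as it is small. -/
lemma insert_insert_mem {K : PreAbstractSimplicialComplex V} {a b : V}
    (hmiss : ∀ T : Finset V, IsMissingFace K T → (∃ F ∈ K, T.card ≤ F.card) → ¬ (a ∈ T ∧ b ∈ T))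
    {Q : Finset V} (ha : insert a Q ∈ K) (hb : insert b Q ∈ K)
    (hcard : ∃ F ∈ K, (insert a (insert b Q)).card ≤ F.card) : insert a (insert b Q) ∈ K := by
  by_contra hK
  obtain ⟨M, hM, hMK⟩ := exists_isMissingFace K (Finset.insert_nonempty _ _) hK
  obtain ⟨F, hF, hle⟩ := hcard
  -- A missing face inside `Q ∪ {a, b}` that avoids `a` or `b` would lie in one of the two given
  -- faces.
  refine hmiss M hMK ⟨F, hF, (Finset.card_le_card hM).trans hle⟩ ⟨?_, ?_⟩
  · by_contra h
    exact hMK.2.1 ((K.isRelLowerSet_faces hb).2 ((Finset.subset_insert_iff_of_notMem h).1 hM)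
      hMK.1)
  · by_contra h
    rw [Finset.insert_comm] at hM
    exact hMK.2.1 ((K.isRelLowerSet_faces ha).2 ((Finset.subset_insert_iff_of_notMem h).1 hM)
      hMK.1)

/-- Faces of a contraction that are not faces of `K`. -/
lemma mem_or_of_mem_map {K : PreAbstractSimplicialComplex V} {a b : V} (hab : a ≠ b)
    {S : Finset V} (hS : S ∈ K.map (fun x => if x = a then b else x)) :
    a ∉ S ∧ (S ∈ K ∨ b ∈ S ∧ insert a (S.erase b) ∈ K) := by
  obtain ⟨S₀, hS₀, rfl⟩ := hS
  change S₀ ∈ K at hS₀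
  change a ∉ S₀.image _ ∧ (S₀.image _ ∈ K ∨ b ∈ S₀.image _ ∧ _)
  have haS : a ∉ S₀.image (fun x => if x = a then b else x) := by
    rw [Finset.mem_image]
    rintro ⟨x, _, hx⟩
    split_ifs at hx with h
    · exact hab hx.symm
    · exact h hx
  refine ⟨haS, ?_⟩
  by_cases ha : a ∈ S₀
  · by_cases hb : b ∈ S₀
    · left
      refine (K.isRelLowerSet_faces hS₀).2 ?_ ((K.isRelLowerSet_faces hS₀).1.image _)
      intro x hx
      obtain ⟨y, hy, rfl⟩ := Finset.mem_image.1 hx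
      split_ifs <;> assumption
    · right
      refine ⟨Finset.mem_image.2 ⟨a, ha, if_pos rfl⟩, ?_⟩
      convert hS₀ using 1
      ext x
      simp only [Finset.mem_insert, Finset.mem_erase, Finset.mem_image]
      constructor
      · rintro (rfl | ⟨hxb, y, hy, rfl⟩)
        · exact ha
        · split_ifs at hxb ⊢ with h
          · exact absurd rfl hxb
          · exact hy
      · intro hx
        by_cases h : x = a
        · exact Or.inl h
        · exact Or.inr ⟨fun h' => hb (h' ▸ hx), x, hx, if_neg h⟩
  · left
    convert hS₀ using 1
    ext x
    simp only [Finset.mem_image]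
    constructor
    · rintro ⟨y, hy, rfl⟩
      rwa [if_neg fun h : y = a => ha (h ▸ hy)]
    · exact fun hx => ⟨x, hx, if_neg fun h : x = a => ha (h ▸ hx)⟩

/-- The carrier of `S` undoes the identification by adding `a` whenever `b ∈ S`. If `b ∈ S`, then
`S` or its lift with `a` in place of `b` is a face of `K`, and the apex is `b` or `a` accordingly.
Coning could only fail for a simplex `F` containing the other of the two vertices; there
admissibility applies, as the cone has at most as many vertices as `S`. -/
lemma DeletedProductMap.of_contraction {K K' : PreAbstractSimplicialComplex V}
    (h : IsAdmissibleContraction K K') : DeletedProductMap K' K := by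
  classical
  obtain ⟨a, b, hab, haK, hbK, hmiss, rfl⟩ := h
  refine .of_carrier
    (fun S => if b ∈ S then (if S ∈ K then b else a) else
      if h : S.Nonempty then h.choose else b)
    (fun S => {x | x ∈ S ∨ x = a ∧ b ∈ S}) ?_ ?_ ?_
  · rintro S T hST x (hx | ⟨hx, hb⟩)
    · exact Or.inl (hST hx)
    · exact Or.inr ⟨hx, hST hb⟩
  · intro S hS F hF hFS hcard
    have hS' := hS
    obtain ⟨haS, hSK⟩ := mem_or_of_mem_map hab hS
    have hne : S.Nonempty := ((K.map _).isRelLowerSet_faces hS').1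
    by_cases hbS : b ∈ S
    · rw [if_pos hbS]
      by_cases hK : S ∈ K
      · rw [if_pos hK]
        refine ⟨?_, Or.inl hbS⟩
        -- If `a ∈ F`, admissibility is applied with `Q = F \ {a}`: `Q ∪ {a}` is the face `F`, and
        -- `Q ∪ {b}` lies in the face `S`.
        by_cases haF : a ∈ F
        · rw [← Finset.insert_erase haF]
          have hFK : F ∈ K := hF.resolve_left (Finset.ne_empty_of_mem haF)
          rw [Finset.insert_comm]
          refine insert_insert_mem hmiss (by rwa [Finset.insert_erase haF]) ?_ ⟨S, hK, ?_⟩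
          · refine (K.isRelLowerSet_faces hK).2 ?_ (Finset.insert_nonempty _ _)
            refine Finset.insert_subset hbS fun x hx => ?_
            obtain ⟨hxa, hx⟩ := Finset.mem_erase.1 hx
            exact (hFS hx).resolve_right fun h => hxa h.1
          · rw [Finset.insert_comm, Finset.insert_erase haF]
            exact (Finset.card_insert_le _ _).trans hcard
        · refine (K.isRelLowerSet_faces hK).2 ?_ (Finset.insert_nonempty _ _)
          refine Finset.insert_subset hbS fun x hx => ?_
          exact (hFS hx).resolve_right fun h => haF (h.1 ▸ hx)
      · rw [if_neg hK]
        have hS₀ : insert a (S.erase b) ∈ K := (hSK.resolve_left hK).2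
        refine ⟨?_, Or.inr ⟨rfl, hbS⟩⟩
        -- The mirror case, with `Q = F \ {b}`. The lift `(S \ {b}) ∪ {a}` has as many vertices as
        -- `S`, so it gives the dimension bound.
        by_cases hbF : b ∈ F
        · have hFK : F ∈ K := hF.resolve_left (Finset.ne_empty_of_mem hbF)
          rw [← Finset.insert_erase hbF]
          refine insert_insert_mem hmiss ?_ (by rwa [Finset.insert_erase hbF])
            ⟨insert a (S.erase b), hS₀, ?_⟩
          · refine (K.isRelLowerSet_faces hS₀).2 ?_ (Finset.insert_nonempty _ _)
            refine Finset.insert_subset (Finset.mem_insert_self _ _) fun x hx => ?_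
            obtain ⟨hxb, hx⟩ := Finset.mem_erase.1 hx
            rcases hFS hx with h | h
            · exact Finset.mem_insert_of_mem (Finset.mem_erase.2 ⟨hxb, h⟩)
            · exact Finset.mem_insert.2 (Or.inl h.1)
          · rw [Finset.insert_erase hbF,
              Finset.card_insert_of_notMem (fun h => haS (Finset.mem_of_mem_erase h)),
              Finset.card_erase_add_one hbS]
            exact (Finset.card_insert_le _ _).trans hcard
        · refine (K.isRelLowerSet_faces hS₀).2 ?_ (Finset.insert_nonempty _ _)
          refine Finset.insert_subset (Finset.mem_insert_self _ _) fun x hx => ?_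
          rcases hFS hx with h | h
          · exact Finset.mem_insert_of_mem (Finset.mem_erase.2 ⟨fun e => hbF (e ▸ hx), h⟩)
          · exact Finset.mem_insert.2 (Or.inl h.1)
    · rw [if_neg hbS, dif_pos hne]
      have hK : S ∈ K := hSK.resolve_right fun h => hbS h.1
      refine ⟨(K.isRelLowerSet_faces hK).2 ?_ (Finset.insert_nonempty _ _),
        Or.inl hne.choose_spec⟩
      refine Finset.insert_subset hne.choose_spec fun x hx => ?_
      exact (hFS hx).resolve_right fun h => hbS h.2
  · intro S hS T hT hd
    have haS := (mem_or_of_mem_map hab hS).1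
    have haT := (mem_or_of_mem_map hab hT).1
    rw [Set.disjoint_left]
    rintro x (hx | ⟨hxa, hx⟩) (hy | ⟨hya, hy⟩)
    · exact Finset.disjoint_left.1 hd hx hy
    · exact haS (hya ▸ hx)
    · exact haT (hxa ▸ hy)
    · exact Finset.disjoint_left.1 hd hx hy

lemma DeletedProductMap.of_minorStep {K K' : PreAbstractSimplicialComplex V}
    (h : MinorStep K K') : DeletedProductMap K' K :=
  h.elim .of_contraction .of_le

lemma DeletedProductMap.of_isMinor {H : PreAbstractSimplicialComplex W}
    {K : PreAbstractSimplicialComplex V} (h : IsMinor H K) : DeletedProductMap H K := by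
  obtain ⟨K', f, hK', hf, hHK'⟩ := h
  have h1 : DeletedProductMap H K' := .of_injOn f hf fun S hS => hHK' ▸ ⟨S, hS, rfl⟩
  refine h1.trans ?_
  clear h1 hHK'
  induction hK' with
  | refl => exact .refl K
  | tail _ hs ih => exact (DeletedProductMap.of_minorStep hs).trans ih

end Minors

/-! ### The singular complex of the infinite-dimensional sphere is acyclic -/

section Sphere

/-- The Hilbert space `ℓ²`. -/
abbrev Ell2 : Type := lp (fun _ : ℕ => ℝ) 2

lemma ell2_add_apply (x y : Ell2) (n : ℕ) : (x + y) n = x n + y n := rfl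

lemma ell2_smul_apply (c : ℝ) (x : Ell2) (n : ℕ) : (c • x) n = c * x n := rfl

lemma ell2_summable (x : Ell2) : Summable fun n => (x n) ^ 2 := by
  have := (lp.memℓp x).summable (by norm_num)
  simpa using this

lemma ell2_norm_sq (x : Ell2) : ‖x‖ ^ 2 = ∑' n, (x n) ^ 2 := by
  have := lp.norm_rpow_eq_tsum (p := 2) (by norm_num) x
  simpa using this

/-- The sequence `0, x 0, x 1, …`. -/
def shiftSeq (x : ℕ → ℝ) : ℕ → ℝ
  | 0 => 0
  | n + 1 => x n

lemma shiftSeq_memℓp (x : Ell2) : Memℓp (E := fun _ : ℕ => ℝ) (shiftSeq x) 2 := by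
  refine memℓp_gen ?_
  rw [← summable_nat_add_iff 1]
  simpa [shiftSeq] using ell2_summable x

/-- The right shift of `ℓ²`. -/
def shift : Ell2 →ₗᵢ[ℝ] Ell2 where
  toFun x := ⟨shiftSeq x, shiftSeq_memℓp x⟩
  map_add' x y := by
    ext n
    rw [ell2_add_apply]
    cases n <;> simp [shiftSeq, ell2_add_apply]
  map_smul' c x := by
    ext n
    cases n <;> simp [shiftSeq]
  norm_map' x := by
    rw [← sq_eq_sq₀ (norm_nonneg _) (norm_nonneg _), ell2_norm_sq, ell2_norm_sq]
    have := (ell2_summable (⟨shiftSeq x, shiftSeq_memℓp x⟩ : Ell2)).tsum_eq_zero_add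
    simpa [shiftSeq] using this

lemma shift_zero (x : Ell2) : shift x 0 = 0 := rfl

lemma shift_succ (x : Ell2) (n : ℕ) : shift x (n + 1) = x n := rfl

/-- The first standard basis vector of `ℓ²`. -/
def ell2Pole : Ell2 := lp.single 2 0 (1 : ℝ)

lemma ell2Pole_zero : ell2Pole 0 = 1 := by simp [ell2Pole]

lemma ell2Pole_succ (n : ℕ) : ell2Pole (n + 1) = 0 := by simp [ell2Pole]

/-- The (not normalized) contraction of the sphere: it moves `w` first to the shift of `w` and
then to the pole. -/
def conePoint (t : ℝ) (w : Ell2) : Ell2 :=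
  max (1 - 2 * t) 0 • w + t • shift w + max (2 * t - 1) 0 • ell2Pole

lemma conePoint_zero (w : Ell2) : conePoint 0 w = w := by simp [conePoint]

lemma conePoint_one : conePoint 1 0 = ell2Pole := by
  norm_num [conePoint]

/-- For `t < 1/2` the pole is absent, and the coordinates of `w` vanish one after the other, since
the shift has no eigenvectors. For `t ≥ 1/2` the term in `w` is absent; the shift only meets the
positive coordinates, so `w = 0`, hence `t = 1`, where the pole has coefficient `1`. Going straight
to the pole would fail at its antipode. -/
lemma conePoint_ne_zero {t : ℝ} {w : Ell2} (hw : ‖w‖ = 1 - t) :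
    conePoint t w ≠ 0 := by
  intro h
  have hz : max (1 - 2 * t) 0 * w 0 + max (2 * t - 1) 0 = 0 := by
    have := congrArg (fun x : Ell2 => x 0) h
    simpa [conePoint, ell2_add_apply, ell2_smul_apply, shift_zero, ell2Pole_zero,
      -lp.coeFn_add, -lp.coeFn_smul] using this
  have hs : ∀ n, max (1 - 2 * t) 0 * w (n + 1) + t * w n = 0 := fun n => by
    have := congrArg (fun x : Ell2 => x (n + 1)) h
    simpa [conePoint, ell2_add_apply, ell2_smul_apply, shift_succ, ell2Pole_succ,
      -lp.coeFn_add, -lp.coeFn_smul] using this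
  rcases lt_or_ge t (1 / 2) with ht | ht
  · rw [max_eq_left (by linarith), max_eq_right (by linarith)] at hz
    rw [max_eq_left (by linarith)] at hs
    have hne : 1 - 2 * t ≠ 0 := by linarith
    have hw0 : ∀ n, w n = 0 := by
      intro n
      induction n with
      | zero => simpa [hne] using hz
      | succ n ih => simpa [hne, ih] using hs n
    have : w = 0 := by ext n; exact hw0 n
    rw [this, norm_zero] at hw
    linarith
  · rw [max_eq_right (by linarith), max_eq_left (by linarith)] at hz
    rw [max_eq_right (by linarith)] at hs
    have hne : t ≠ 0 := by linarith
    have : w = 0 := by ext n; simpa [hne] using hs n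
    rw [this, norm_zero] at hw
    linarith

/-- Radial projection to the sphere. -/
def normalize (x : Ell2) (hx : x ≠ 0) : SphereInf :=
  ⟨‖x‖⁻¹ • x, by simp [norm_smul, hx]⟩

/-- The projection of a simplex from its first vertex to the opposite face. -/
def simplexTail {n : ℕ} (s : stdSimplex ℝ (Fin (n + 2))) (h : s 0 ≠ 1) :
    stdSimplex ℝ (Fin (n + 1)) :=
  ⟨fun i => s i.succ / (1 - s 0), fun i => div_nonneg (stdSimplex.zero_le s _)
    (sub_nonneg.2 (stdSimplex.le_one s 0)), by
    have h1 : 1 - s 0 ≠ 0 := fun h' => h (by linarith)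
    have := stdSimplex.sum_eq_one s
    rw [Fin.sum_univ_succ] at this
    rw [← Finset.sum_div, div_eq_one_iff_eq h1]
    linarith⟩

lemma simplexTail_apply {n : ℕ} (s : stdSimplex ℝ (Fin (n + 2))) (h : s 0 ≠ 1) (i : Fin (n + 1)) :
    simplexTail s h i = s i.succ / (1 - s 0) := rfl

open Classical in
/-- The radial extension of `σ` to the cone over the simplex. -/
def radial {n : ℕ} (σ : SingSimplex SphereInf n) (s : stdSimplex ℝ (Fin (n + 2))) : Ell2 :=
  if h : s 0 = 1 then 0 else (1 - s 0) • (σ (simplexTail s h) : Ell2)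

lemma norm_radial {n : ℕ} (σ : SingSimplex SphereInf n) (s : stdSimplex ℝ (Fin (n + 2))) :
    ‖radial σ s‖ = 1 - s 0 := by
  have h1 := stdSimplex.le_one s 0
  unfold radial
  split_ifs with h
  · simp [h]
  · rw [norm_smul, norm_eq_of_mem_sphere, mul_one, Real.norm_of_nonneg (by linarith)]

lemma continuous_coord {ι : Type*} [Fintype ι] (i : ι) :
    Continuous fun s : stdSimplex ℝ ι => s i :=
  (continuous_apply i).comp continuous_subtype_val

lemma continuous_radial {n : ℕ} (σ : SingSimplex SphereInf n) : Continuous (radial σ) := by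
  have hc : Continuous fun s : stdSimplex ℝ (Fin (n + 2)) => 1 - s 0 :=
    continuous_const.sub (continuous_coord 0)
  rw [continuous_iff_continuousAt]
  intro s
  by_cases hs : s 0 = 1
  -- At the apex the projection `simplexTail` has no limit, but the factor `1 - s 0` bounds the norm
  -- and tends to zero.
  · have h0 : radial σ s = 0 := by rw [radial, dif_pos hs]
    rw [ContinuousAt, h0]
    refine squeeze_zero_norm (a := fun s => 1 - s 0) (fun s => (norm_radial σ s).le) ?_
    have := hc.tendsto s
    rwa [hs, sub_self] at this
  · have hopen : IsOpen {s : stdSimplex ℝ (Fin (n + 2)) | s 0 ≠ 1} :=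
      isOpen_ne_fun (continuous_coord 0) continuous_const
    refine ContinuousOn.continuousAt ?_ (hopen.mem_nhds hs)
    rw [continuousOn_iff_continuous_domRestrict]
    have h : Set.domRestrict {s : stdSimplex ℝ (Fin (n + 2)) | s 0 ≠ 1} (radial σ)
        = fun s => (1 - s.1 0) • (σ (simplexTail s.1 s.2) : Ell2) := by
      funext s
      exact dif_neg s.2
    rw [h]
    refine (hc.comp continuous_subtype_val).smul
      (continuous_subtype_val.comp (σ.continuous.comp (Continuous.subtype_mk ?_ _)))
    refine continuous_pi fun i => ?_
    exact ((continuous_coord i.succ).comp continuous_subtype_val).div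
      (hc.comp continuous_subtype_val) fun s h' => s.2 (by linarith)

/-- The cone over a singular simplex of the sphere. -/
def coneSimplex {n : ℕ} (σ : SingSimplex SphereInf n) : SingSimplex SphereInf (n + 1) where
  toFun s := normalize (conePoint (s 0) (radial σ s))
    (conePoint_ne_zero (norm_radial σ s))
  continuous_toFun := by
    have h : Continuous fun s => conePoint (s 0) (radial σ s) := by
      have h1 := continuous_radial σ
      have h2 := continuous_coord (ι := Fin (n + 2)) 0
      have h3 := shift.continuous.comp h1
      unfold conePoint
      exact (((continuous_const.sub (continuous_const.mul h2)).max continuous_const).smul h1).add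
        (h2.smul h3) |>.add
        ((((continuous_const.mul h2).sub continuous_const).max continuous_const).smul
          continuous_const)
    refine Continuous.subtype_mk ?_ _
    exact (h.norm.inv₀ fun s => norm_ne_zero_iff.2
      (conePoint_ne_zero (norm_radial σ s))).smul h

lemma coneSimplex_apply {n : ℕ} (σ : SingSimplex SphereInf n) (s : stdSimplex ℝ (Fin (n + 2))) :
    (coneSimplex σ s : Ell2)
      = ‖conePoint (s 0) (radial σ s)‖⁻¹ • conePoint (s 0) (radial σ s) := rfl

lemma simplexMap_succAbove_self {n : ℕ} (i : Fin (n + 2)) (s : stdSimplex ℝ (Fin (n + 1))) :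
    simplexMap i.succAbove s i = 0 := by
  simp [simplexMap, FunOnFinite.linearMap_apply_apply, Fin.succAbove_ne]

lemma simplexMap_succAbove_apply {n : ℕ} (i : Fin (n + 2)) (s : stdSimplex ℝ (Fin (n + 1)))
    (j : Fin (n + 1)) : simplexMap i.succAbove s (i.succAbove j) = s j := by
  simp [simplexMap, FunOnFinite.linearMap_apply_apply, Finset.filter_eq']

lemma coneSimplex_face_zero {n : ℕ} (σ : SingSimplex SphereInf n) : (coneSimplex σ).face 0 = σ := by
  refine ContinuousMap.ext fun s => Subtype.ext ?_
  have h0 := simplexMap_succAbove_self 0 s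
  have hne : simplexMap (Fin.succAbove 0) s 0 ≠ 1 := by rw [h0]; exact zero_ne_one
  have ht : simplexTail (simplexMap (Fin.succAbove 0) s) hne = s := by
    refine stdSimplex.ext (funext fun i => ?_)
    have := simplexMap_succAbove_apply 0 s i
    rw [Fin.succAbove_zero_apply] at this
    rw [simplexTail_apply, h0, this, sub_zero, div_one]
  change (coneSimplex σ (simplexMap (Fin.succAbove 0) s) : Ell2) = _
  rw [coneSimplex_apply, radial, dif_neg hne, ht, h0, conePoint_zero, sub_zero, one_smul,
    norm_eq_of_mem_sphere, inv_one, one_smul]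

/-- A face containing the apex keeps the coordinate `s 0`, and projecting away from the apex
commutes with the inclusion of the face. -/
lemma coneSimplex_face_succ {n : ℕ} (σ : SingSimplex SphereInf (n + 1)) (i : Fin (n + 2)) :
    (coneSimplex σ).face i.succ = coneSimplex (σ.face i) := by
  refine ContinuousMap.ext fun s => Subtype.ext ?_
  have h0 : simplexMap i.succ.succAbove s 0 = s 0 := by
    have := simplexMap_succAbove_apply i.succ s 0
    rwa [Fin.succ_succAbove_zero] at this
  have hr : radial σ (simplexMap i.succ.succAbove s) = radial (σ.face i) s := by
    unfold radial
    by_cases h : s 0 = 1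
    · rw [dif_pos h, dif_pos (h0.trans h)]
    · have h' : simplexMap i.succ.succAbove s 0 ≠ 1 := fun e => h (h0.symm.trans e)
      rw [dif_neg h, dif_neg h', h0]
      have ht : simplexTail (simplexMap i.succ.succAbove s) h'
          = simplexMap i.succAbove (simplexTail s h) := by
        refine stdSimplex.ext (funext fun j => ?_)
        rcases Fin.eq_self_or_eq_succAbove i j with rfl | ⟨k, rfl⟩
        · rw [simplexTail_apply, simplexMap_succAbove_self, simplexMap_succAbove_self, zero_div]
        · rw [simplexTail_apply, simplexMap_succAbove_apply, ← Fin.succ_succAbove_succ,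
            simplexMap_succAbove_apply, simplexTail_apply, h0]
      rw [ht]
      rfl
  change (coneSimplex σ (simplexMap i.succ.succAbove s) : Ell2) = _
  rw [coneSimplex_apply, coneSimplex_apply, h0, hr]

lemma norm_ell2Pole : ‖ell2Pole‖ = 1 := by
  simp [ell2Pole]

/-- The singular vertex at the pole. -/
def poleSimplex : SingSimplex SphereInf 0 :=
  ContinuousMap.const _ ⟨ell2Pole, by simp [norm_ell2Pole]⟩

lemma coneSimplex_face_one (σ : SingSimplex SphereInf 0) : (coneSimplex σ).face 1 = poleSimplex := by
  refine ContinuousMap.ext fun s => Subtype.ext ?_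
  have h0 : simplexMap (Fin.succAbove 1) s 0 = 1 := by
    have := simplexMap_succAbove_apply 1 s 0
    rw [Fin.succAbove_of_castSucc_lt _ _ (by simp)] at this
    have h1 := stdSimplex.sum_eq_one s
    rw [Fin.sum_univ_succ, Finset.univ_eq_empty, Finset.sum_empty, add_zero] at h1
    exact this.trans h1
  change (coneSimplex σ (simplexMap (Fin.succAbove 1) s) : Ell2) = ell2Pole
  rw [coneSimplex_apply, radial, dif_pos h0, h0, conePoint_one, norm_ell2Pole, inv_one, one_smul]

/-- The cone operator on singular chains. -/
def singCone (n : ℕ) : (SingSimplex SphereInf n →₀ ℤ) →+ (SingSimplex SphereInf (n + 1) →₀ ℤ) :=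
  Finsupp.mapDomain.addMonoidHom coneSimplex

lemma singCone_single {n : ℕ} (σ : SingSimplex SphereInf n) :
    singCone n (Finsupp.single σ 1) = Finsupp.single (coneSimplex σ) 1 := by
  simp [singCone]

lemma singBoundary_singCone (n : ℕ) (x : SingSimplex SphereInf (n + 1) →₀ ℤ) :
    singBoundary SphereInf (n + 1) (singCone (n + 1) x)
      = x - singCone n (singBoundary SphereInf n x) := by
  suffices h : (singBoundary SphereInf (n + 1)).comp (singCone (n + 1))
      = AddMonoidHom.id _ - (singCone n).comp (singBoundary SphereInf n) from
    DFunLike.congr_fun h x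
  apply Finsupp.addHom_ext'
  intro σ
  ext1
  simp only [AddMonoidHom.comp_apply, Finsupp.singleAddHom_apply, AddMonoidHom.sub_apply,
    AddMonoidHom.id_apply, singCone_single, singBoundary_single, map_sum, map_zsmul]
  rw [Fin.sum_univ_succ, coneSimplex_face_zero, sub_eq_add_neg, ← Finset.sum_neg_distrib]
  congr 1
  · simp
  · refine Finset.sum_congr rfl fun i _ => ?_
    rw [coneSimplex_face_succ, Fin.val_succ, pow_succ, mul_neg_one, neg_smul]

/-- The cone over a point is a path to the pole, so in degree `0` the cone operator only bounds
chains of augmentation zero. -/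
lemma singBoundary_singCone_zero (x : SingSimplex SphereInf 0 →₀ ℤ) :
    singBoundary SphereInf 0 (singCone 0 x) = x - coeffSum _ x • Finsupp.single poleSimplex 1 := by
  suffices h : (singBoundary SphereInf 0).comp (singCone 0) = AddMonoidHom.id _ -
      ((coeffSum _).smulRight (Finsupp.single poleSimplex (1 : ℤ))).toAddMonoidHom from
    DFunLike.congr_fun h x
  apply Finsupp.addHom_ext'
  intro σ
  ext1
  simp [singCone_single, singBoundary_single, Fin.sum_univ_succ, coneSimplex_face_zero,
    coneSimplex_face_one, coeffSum_single, sub_eq_add_neg]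

lemma exists_singBoundary_eq {n : ℕ} (x : SingSimplex SphereInf (n + 1) →₀ ℤ)
    (hx : singBoundary SphereInf n x = 0) : ∃ y, singBoundary SphereInf (n + 1) y = x :=
  ⟨singCone (n + 1) x, by rw [singBoundary_singCone, hx, map_zero, sub_zero]⟩

lemma exists_singBoundary_eq_zero (x : SingSimplex SphereInf 0 →₀ ℤ) (hx : coeffSum _ x = 0) :
    ∃ y, singBoundary SphereInf 0 y = x :=
  ⟨singCone 0 x, by rw [singBoundary_singCone_zero, hx, zero_smul, sub_zero]⟩

end Sphere

/-! ### Uniqueness of equivariant chain maps to the sphere -/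

section Homotopy

variable {V : Type u} [LinearOrder V]

/-- The cell `T × S`. -/
def swapCell {K : PreAbstractSimplicialComplex V} {j : ℕ} (c : Cell K j) : Cell K j :=
  ⟨(c.1.2, c.1.1), c.2.symm⟩

/-- The sign of the involution on a cell. -/
def swapSign {K : PreAbstractSimplicialComplex V} {j : ℕ} (c : Cell K j) : ℤ :=
  (-1) ^ ((c.1.1.card - 1) * (c.1.2.card - 1))

omit [LinearOrder V] in
lemma swapSign_mul_self {K : PreAbstractSimplicialComplex V} {j : ℕ} (c : Cell K j) :
    swapSign c * swapSign c = 1 := by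
  simp [swapSign, ← mul_pow]

omit [LinearOrder V] in
lemma swapSign_swapCell {K : PreAbstractSimplicialComplex V} {j : ℕ} (c : Cell K j) :
    swapSign (swapCell c) = swapSign c := by
  simp [swapSign, swapCell, mul_comm]

omit [LinearOrder V] in
lemma cellSwap_single {K : PreAbstractSimplicialComplex V} {j : ℕ} (c : Cell K j) :
    cellSwap K j (Finsupp.single c 1) = swapSign c • Finsupp.single (swapCell c) 1 := by
  rw [← cell_of_isCell c.2, cellSwap_cell, cell_of_isCell c.2.symm]
  rfl

/-- One of the cells `S × T` and `T × S` is chosen. -/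
def IsChosen {K : PreAbstractSimplicialComplex V} {j : ℕ} (c : Cell K j) : Prop :=
  c.1.1.min < c.1.2.min

/-- Disjoint nonempty faces have different least vertices, so exactly one cell of each orbit is
chosen. This is the freeness of the action. -/
lemma isChosen_swapCell {K : PreAbstractSimplicialComplex V} {j : ℕ} (c : Cell K j) :
    IsChosen (swapCell c) ↔ ¬ IsChosen c := by
  have hne : c.1.1.min ≠ c.1.2.min := by
    obtain ⟨a, ha⟩ := Finset.min_of_nonempty c.2.nonempty.1
    intro h
    exact Finset.disjoint_left.1 c.2.2.2.1 (Finset.mem_of_min ha) (Finset.mem_of_min (h ▸ ha))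
  change c.1.2.min < c.1.1.min ↔ ¬ c.1.1.min < c.1.2.min
  rw [not_lt]
  exact ⟨le_of_lt, fun h => lt_of_le_of_ne h hne.symm⟩

/-- The chosen cells form a basis of the chains over `ℤ[ℤ/2]`: the lift is arbitrary on them and is
extended to the swapped cells by equivariance. -/
lemma exists_equivariant_lift {K : PreAbstractSimplicialComplex V} {B : InvComplex.{v}} {j k : ℕ}
    (F : (cellComplex K).C j →+ B.C k) (hF : ∀ x, F ((cellComplex K).τ j x) = B.τ k (F x))
    (h : ∀ x, ∃ y, B.d k y = F x) :
    ∃ D : (cellComplex K).C j →+ B.C (k + 1),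
      (∀ x, D ((cellComplex K).τ j x) = B.τ (k + 1) (D x)) ∧ ∀ x, B.d k (D x) = F x := by
  classical
  choose y hy using fun c : Cell K j => h (Finsupp.single c (1 : ℤ))
  let D : (Cell K j →₀ ℤ) →+ B.C (k + 1) := (Finsupp.linearCombination ℤ fun c : Cell K j =>
    if IsChosen c then y c else swapSign c • B.τ (k + 1) (y (swapCell c))).toAddMonoidHom
  have hD : ∀ c, D (Finsupp.single c 1)
      = if IsChosen c then y c else swapSign c • B.τ (k + 1) (y (swapCell c)) := by
    intro c
    simp [D]
  have hFc : ∀ c : Cell K j, F (Finsupp.single (swapCell c) (1 : ℤ))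
      = swapSign c • B.τ k (F (Finsupp.single c (1 : ℤ))) := by
    intro c
    have h1 := hF (Finsupp.single c (1 : ℤ))
    change F (cellSwap K j (Finsupp.single c 1)) = _ at h1
    rw [cellSwap_single] at h1
    erw [map_zsmul] at h1
    rw [← h1, smul_smul, swapSign_mul_self, one_smul]
  refine ⟨D, fun x => ?_, fun x => ?_⟩
  · suffices e : D.comp (cellSwap K j) = (B.τ (k + 1)).comp D from DFunLike.congr_fun e x
    apply Finsupp.addHom_ext'
    intro c
    ext1
    simp only [AddMonoidHom.comp_apply, Finsupp.singleAddHom_apply, cellSwap_single, map_zsmul, hD,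
      isChosen_swapCell, swapSign_swapCell]
    by_cases hc : IsChosen c
    · rw [if_neg (not_not.2 hc), if_pos hc, smul_smul, swapSign_mul_self, one_smul]
      rfl
    · rw [if_pos hc, if_neg hc, map_zsmul, B.τ_τ]
  · suffices e : (B.d k).comp D = F from DFunLike.congr_fun e x
    apply Finsupp.addHom_ext'
    intro c
    ext1
    simp only [AddMonoidHom.comp_apply, Finsupp.singleAddHom_apply, hD]
    split_ifs with hc
    · exact hy c
    · rw [map_zsmul, B.d_τ, hy, hFc, map_zsmul, B.τ_τ, smul_smul, swapSign_mul_self, one_smul]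
      rfl

variable {K : PreAbstractSimplicialComplex V} (f g : (cellComplex K).Hom (singComplex antipode))

lemma exists_equivariant_homotopy_zero
    (hfg : ∀ x, coeffSum (SingSimplex SphereInf 0) (f.f 0 x) = coeffSum _ (g.f 0 x)) :
    ∃ D : (cellComplex K).C 0 →+ (singComplex antipode).C 1,
      (∀ x, D ((cellComplex K).τ 0 x) = (singComplex antipode).τ 1 (D x)) ∧
      ∀ x, (singComplex antipode).d 0 (D x) = f.f 0 x - g.f 0 x := by
  refine exists_equivariant_lift (f.f 0 - g.f 0) (fun x => ?_) (fun x => ?_)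
  · simp only [AddMonoidHom.sub_apply, f.map_τ, g.map_τ, map_sub]
  · refine exists_singBoundary_eq_zero (f.f 0 x - g.f 0 x) ?_
    exact (map_sub (coeffSum (SingSimplex SphereInf 0)) _ _).trans (sub_eq_zero.2 (hfg x))

/-- The usual inductive construction of a homotopy. What passes to the next degree is that `f - g -
D ∂` takes values in boundaries, which is the input of `exists_equivariant_lift`; it holds because
these values are cycles of positive degree in an acyclic complex. -/
lemma exists_equivariant_homotopy
    (hfg : ∀ x, coeffSum (SingSimplex SphereInf 0) (f.f 0 x) = coeffSum _ (g.f 0 x)) (n : ℕ) :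
    ∃ D : (cellComplex K).C n →+ (singComplex antipode).C (n + 1),
      (∀ x, D ((cellComplex K).τ n x) = (singComplex antipode).τ (n + 1) (D x)) ∧
      ∀ x, ∃ y, (singComplex antipode).d (n + 1) y
        = f.f (n + 1) x - g.f (n + 1) x - D ((cellComplex K).d n x) := by
  induction n with
  | zero =>
    obtain ⟨D, hτ, hd⟩ := exists_equivariant_homotopy_zero f g hfg
    refine ⟨D, hτ, fun x => exists_singBoundary_eq _ ?_⟩
    change (singComplex antipode).d 0 _ = 0
    rw [map_sub, map_sub, hd, f.map_d, g.map_d, sub_self]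
  | succ n ih =>
    obtain ⟨D, hτ, hy⟩ := ih
    obtain ⟨D', hτ', hd'⟩ := exists_equivariant_lift
      (f.f (n + 1) - g.f (n + 1) - D.comp ((cellComplex K).d n))
      (fun x => by
        simp only [AddMonoidHom.sub_apply, AddMonoidHom.comp_apply, f.map_τ, g.map_τ, map_sub,
          (cellComplex K).d_τ, hτ]) hy
    refine ⟨D', hτ', fun x => exists_singBoundary_eq _ ?_⟩
    change (singComplex antipode).d (n + 1) _ = 0
    rw [map_sub, map_sub, hd']
    simp only [AddMonoidHom.sub_apply, AddMonoidHom.comp_apply, (cellComplex K).d_d, map_zero,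
      sub_zero, f.map_d, g.map_d, sub_self]

/-- Equivariant chain maps `C_•(K_×) → C_•(S^∞)` with the same augmentation induce the same map
of equivariant cohomology. -/
lemma pullback_eq_of_coeffSum_eq
    (hfg : ∀ x, coeffSum (SingSimplex SphereInf 0) (f.f 0 x) = coeffSum _ (g.f 0 x)) (m : ℕ) :
    f.pullback m = g.pullback m := by
  ext z
  obtain ⟨c, hc⟩ := z
  have hcd : ∀ y, c ((singComplex antipode).d m y) = 0 := fun y => DFunLike.congr_fun hc.2 y
  refine (QuotientAddGroup.eq.2 ?_).symm
  rw [AddSubgroup.mem_addSubgroupOf]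
  change -(c.comp (g.f m)) + c.comp (f.f m) ∈ (cellComplex K).eqCoboundaries m
  cases m with
  | zero =>
    obtain ⟨D, -, hd⟩ := exists_equivariant_homotopy_zero f g hfg
    change -(c.comp (g.f 0)) + c.comp (f.f 0) = 0
    ext x
    have := hcd (D x)
    rw [hd, map_sub] at this
    change -(c (g.f 0 x)) + c (f.f 0 x) = 0
    linarith
  | succ m =>
    obtain ⟨D, hτ, hy⟩ := exists_equivariant_homotopy f g hfg m
    -- The cocycle `c` kills the boundary `f x - g x - D (∂ x)`, so the coboundary of `c ∘ D` is `c
    -- ∘ f - c ∘ g`; equivariance of `D` gives `c ∘ D` the symmetry of `c`.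
    refine ⟨c.comp D, fun x => ?_, ?_⟩
    · change c (D _) = (-1) ^ (m + 1) * c (D x)
      rw [hτ]
      exact hc.1 (D x)
    · refine AddMonoidHom.ext fun x => ?_
      obtain ⟨y, hy⟩ := hy x
      have := hcd y
      rw [hy, map_sub, map_sub] at this
      change c (D ((cellComplex K).d m x)) = -(c (g.f (m + 1) x)) + c (f.f (m + 1) x)
      linarith

end Homotopy

/-- The composition of a comparison map and a `ℤ/2`-map to the sphere preserves augmentations. -/
lemma coeffSum_chainMap_comp {V : Type u} [LinearOrder V] {K : PreAbstractSimplicialComplex V}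
    (η : Comparison K) (i : EquivariantMap (realizationSwap K) antipode)
    (x : (cellComplex K).C 0) :
    coeffSum (SingSimplex SphereInf 0) ((i.chainMap.comp η.hom).f 0 x) = coeffSum (Cell K 0) x := by
  refine (sum_coeff_preserved (f := singMap i.map 0) (fun σ => ?_) _).trans
    (sum_coeff_preserved (f := η.hom.f 0) (fun c => ?_) x)
  · rw [singMap_single, coeffSum_single]
  · rw [coeffSum_apply]
    exact η.vertex c

end VanKampen

end

theorem mainTheorem3 {V W : Type*} [LinearOrder V] [LinearOrder W]
    (H : PreAbstractSimplicialComplex W) (K : PreAbstractSimplicialComplex V)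
    (hH : H.faces.Finite) (hK : K.faces.Finite) (hHK : VanKampen.IsMinor H K) (m : ℕ)
    (oH : (VanKampen.cellComplex H).Heq m) (oK : (VanKampen.cellComplex K).Heq m)
    (hoH : VanKampen.IsVanKampenObstruction H m oH)
    (hoK : VanKampen.IsVanKampenObstruction K m oK)
    (hne : oH ≠ 0) : oK ≠ 0 := by
  obtain ⟨ηH, iH, zH, -, rfl⟩ := hoH
  obtain ⟨ηK, iK, zK, hzK, rfl⟩ := hoK
  obtain ⟨g, hg⟩ := VanKampen.DeletedProductMap.of_isMinor hHK
  intro hzero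
  -- The class used for `H` is a multiple of the generator used for `K`, so the ambiguity of sign
  -- plays no role.
  obtain ⟨n, rfl⟩ := AddSubgroup.mem_zmultiples_iff.1 (hzK ▸ AddSubgroup.mem_top zH)
  -- Both chain maps from `C_•(H_×)` preserve augmentations, so no relation between the chosen
  -- `ℤ/2`-maps or comparison maps is needed.
  have h := VanKampen.pullback_eq_of_coeffSum_eq (iH.chainMap.comp ηH.hom)
    ((iK.chainMap.comp ηK.hom).comp g) (fun x => by
      rw [VanKampen.coeffSum_chainMap_comp ηH iH]
      exact ((VanKampen.coeffSum_chainMap_comp ηK iK (g.f 0 x)).trans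
        (VanKampen.sum_coeff_preserved (f := g.f 0) hg x)).symm) m
  have hcomp : ((iK.chainMap.comp ηK.hom).comp g).pullback m zK
      = g.pullback m (VanKampen.inducedMap ηK iK m zK) := by
    induction zK using QuotientAddGroup.induction_on
    rfl
  refine hne ?_
  rw [VanKampen.inducedMap, map_zsmul, h, hcomp, hzero, map_zero, zsmul_zero]
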